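/- Let $A\in\mathbb R^{n\times n}$ and $b,c\in\mathbb R^n$ with $(A,b)$ controllable, let $\Omega\subset\mathbb R^n$ be compact and convex, $\theta\in\Omega$, $x_0\in\mathbb R^n$, and let $r:[0,\infty)\to\mathbb R$ be bounded and continuous. Consider the plant $$\dot x(t)=Ax(t)+b\,(u(t)-\theta^\top x(t)),\quad x(0)=x_0,\qquad y(t)=c^\top x(t).$$ Let $K\in\mathbb R^n$ be such that $A_m=A-bK^\top$ is Hurwitz, put $H_o(s)=(sI-A_m)^{-1}b$, assume $c^\top H_o(0)\neq0$ and set $k_g=1/(c^\top H_o(0))$. Let $C(s)$ be a stable, strictly proper, rational single-input single-output transfer function with $C(0)=1$; $C(s)$ acts on signals with zero initial filter state, i.e. by convolution with its impulse response. Let $Q$ be symmetric positive definite, let $P$ be the solution of $A_m^\top P+PA_m=-Q$, let $\hat\theta_0\in\Omega$, and for $\Gamma_c>0$ let the $\mathcal L_1$ adaptive controller be $$u=-K^\top x+u_2,\qquad u_2(s)=C(s)\big(\bar r(s)+k_g r(s)\big),\qquad \bar r(t)=\hat\theta(t)^\top x(t),$$ $$\dot{\hat x}=A_m\hat x-b\,\hat\theta^\top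 x+b\,u_2,\quad \hat x(0)=x_0,\qquad \dot{\hat\theta}=\Gamma_c\,\mathrm{Proj}\big(\hat\theta,\;x\,(\hat x-x)^\top Pb\big),\quad \hat\theta(0)=\hat\theta_0,$$ where $\mathrm{Proj}(\vartheta,v)$ is the Euclidean projection of $v$ onto the tangent cone of $\Omega$ at $\vartheta\in\Omega$, and $\hat\theta$ is locally absolutely continuous and satisfies its equation for almost every $t\ge0$. Suppose that $$\|\bar G\|_{\mathcal L_1}\,\theta_{\max}<1,\qquad \bar G(s)=H_o(s)(C(s)-1),\qquad \theta_{\max}=\max_{\vartheta\in\Omega}\sum_{i=1}^n|\vartheta_i|,$$ where $\|\bar G\|_{\mathcal L_1}=\max_i\int_0^\infty|\bar g_i(t)|\,dt$ and $\bar g$ is the impulse response of $\bar G$. Let $x_{ref},u_{ref},y_{ref}=c^\top x_{ref}$ be the signals of the reference system, that is, of the same plant with the same initial state in closed loop with the ideal controller $$u_{ref}(s)=C(s)\big(k_g r(s)+\eta(s)\big)-K^\top x_{ref}(s),\qquad \eta(t)=\theta^\top x_{ref}(t).$$ If $x,y,u$ (depending on $\Gamma_c$) are the signals of the adaptive closed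 loop on $[0,\infty)$, then for every $t\ge0$ $$\lim_{\Gamma_c\to\infty}\big(x(t)-x_{ref}(t)\big)=0,\qquad \lim_{\Gamma_c\to\infty}\big(y(t)-y_{ref}(t)\big)=0,\qquad \lim_{\Gamma_c\to\infty}\big(u(t)-u_{ref}(t)\big)=0,$$ and all three limits are uniform in $t\in[0,\infty)$. -/

import Mathlib

open Filter Topology MeasureTheory Set Matrix
open scoped ENNReal

noncomputable section

namespace L1Adaptive

/-! ### Linear time-invariant systems -/

/-- A real square matrix is Hurwitz if all its (complex) eigenvalues have negative real part. -/
def IsHurwitz {n : ℕ} (A : Matrix (Fin n) (Fin n) ℝ) : Prop :=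
  ∀ z ∈ spectrum ℂ (A.map (fun a : ℝ => (a : ℂ))), z.re < 0

/-- Controllability of `(A, b)`: the matrix with columns `b, A b, …, A ^ (n - 1) b` has rank `n`. -/
def IsControllable {n : ℕ} (A : Matrix (Fin n) (Fin n) ℝ) (b : Fin n → ℝ) : Prop :=
  (Matrix.of fun i k : Fin n => ((A ^ (k : ℕ)) *ᵥ b) i).rank = n

/-- The impulse response `e^{At} b` of the single-input system `(s I - A)⁻¹ b`. -/
def stateImpulse {n : ℕ} (A : Matrix (Fin n) (Fin n) ℝ) (b : Fin n → ℝ) (t : ℝ) : Fin n → ℝ :=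
  NormedSpace.exp (t • A) *ᵥ b

/-- The value at a real point `s` of the transfer function `cᵀ (s I - A)⁻¹ b`. -/
def transferAt {n : ℕ} (A : Matrix (Fin n) (Fin n) ℝ) (b c : Fin n → ℝ) (s : ℝ) : ℝ :=
  c ⬝ᵥ ((s • (1 : Matrix (Fin n) (Fin n) ℝ) - A)⁻¹ *ᵥ b)

/-- A strictly proper rational single-input single-output system `C(s) = cᵀ (s I - A)⁻¹ b`,
given by a state-space realization. -/
structure StrictlyProperSystem where
  /-- the order of the realization -/
  order : ℕ
  A : Matrix (Fin order) (Fin order) ℝ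
  b : Fin order → ℝ
  c : Fin order → ℝ

namespace StrictlyProperSystem

/-- The value of the transfer function `C(s)` at a real point `s`. -/
def transfer (C : StrictlyProperSystem) (s : ℝ) : ℝ := transferAt C.A C.b C.c s

/-- The impulse response `cᵀ e^{At} b`, i.e. the inverse Laplace transform of `C(s)`. -/
def impulse (C : StrictlyProperSystem) (t : ℝ) : ℝ := C.c ⬝ᵥ stateImpulse C.A C.b t

/-- The output of `C(s)` (from zero filter state) for the input `v`: the time-domain form of
the Laplace-domain product `C(s) v(s)`. -/
def response (C : StrictlyProperSystem) (v : ℝ → ℝ) (t : ℝ) : ℝ :=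
  ∫ τ in (0 : ℝ)..t, C.impulse (t - τ) * v τ

/-- Stability: the realization has only poles in the open left half plane. Every stable strictly
proper rational transfer function has such a realization. -/
def IsStable (C : StrictlyProperSystem) : Prop := IsHurwitz C.A

end StrictlyProperSystem

/-- The `𝓛₁` gain of a single-input `n`-output system with impulse response `g`:
the maximum over the outputs `i` of `∫₀^∞ |g i t| dt`. -/
def l1Gain {n : ℕ} (g : ℝ → Fin n → ℝ) : ℝ≥0∞ :=
  ⨆ i, ∫⁻ t in Ioi (0 : ℝ), ENNReal.ofReal |g t i|

/-! ### The projection operator -/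

/-- `v = Proj(ϑ, y)`: `v` is the Euclidean projection of `y` onto the tangent cone of `Ω` at `ϑ`
(thus `v = y` when `ϑ` is interior to `Ω`, or when `y` does not point outwards at a boundary
point). -/
def IsProj {n : ℕ} (Ω : Set (Fin n → ℝ)) (ϑ y v : Fin n → ℝ) : Prop :=
  v ∈ posTangentConeAt Ω ϑ ∧
    ∀ w ∈ posTangentConeAt Ω ϑ, (y - v) ⬝ᵥ (y - v) ≤ (y - w) ⬝ᵥ (y - w)

/-! ### The plant and the controller -/

/-- The data of the plant and of the `𝓛₁` adaptive controller, apart from the gain `Γ_c`. -/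
structure Data (n : ℕ) where
  /-- plant matrix -/
  A : Matrix (Fin n) (Fin n) ℝ
  /-- input vector -/
  b : Fin n → ℝ
  /-- output vector -/
  c : Fin n → ℝ
  /-- unknown constant parameter -/
  θ : Fin n → ℝ
  /-- the known set of admissible parameters -/
  Ω : Set (Fin n → ℝ)
  /-- static feedback gain -/
  K : Fin n → ℝ
  /-- the low-pass filter `C(s)` -/
  C : StrictlyProperSystem
  /-- the matrix `P` of the adaptive law -/
  P : Matrix (Fin n) (Fin n) ℝ
  /-- reference signal -/
  r : ℝ → ℝ
  /-- initial state -/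
  x₀ : Fin n → ℝ
  /-- initial parameter estimate -/
  θhat₀ : Fin n → ℝ

namespace Data

variable {n : ℕ} (S : Data n)

/-- `A_m = A - b Kᵀ`. -/
def Am : Matrix (Fin n) (Fin n) ℝ := S.A - vecMulVec S.b S.K

/-- `k_g = 1 / (cᵀ H_o(0))`, where `H_o(s) = (s I - A_m)⁻¹ b`. -/
def kg : ℝ := 1 / transferAt S.Am S.b S.c 0

/-- The impulse response of `Ḡ(s) = H_o(s) (C(s) - 1)`: the convolution of the impulse responses
of `H_o` and `C`, minus the impulse response of `H_o`. -/
def gBar (t : ℝ) : Fin n → ℝ := fun i =>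
  (∫ τ in (0 : ℝ)..t, stateImpulse S.Am S.b (t - τ) i * S.C.impulse τ)
    - stateImpulse S.Am S.b t i

/-- `θ_max`, the maximum of `∑ |ϑ i|` over `ϑ ∈ Ω`. -/
def thetaMax : ℝ := sSup ((fun ϑ : Fin n → ℝ => ∑ i, |ϑ i|) '' S.Ω)

/-- The `𝓛₁`-gain requirement `‖Ḡ‖ θ_max < 1`. -/
def GainRequirement : Prop := l1Gain S.gBar * ENNReal.ofReal S.thetaMax < 1

/-- The plant `ẋ = A x + b (u - θᵀ x)`, `x(0) = x₀`, on `[0, ∞)`. -/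
def IsPlantSolution (x : ℝ → Fin n → ℝ) (u : ℝ → ℝ) : Prop :=
  x 0 = S.x₀ ∧ ∀ t, 0 ≤ t →
    HasDerivWithinAt x (S.A *ᵥ x t + (u t - S.θ ⬝ᵥ x t) • S.b) (Ici 0) t

/-- The plant in closed loop with the `𝓛₁` adaptive controller with gain `Γ = Γ_c I`; `xhat` is the
predictor state, `θhat` the parameter estimate and `u` the control signal. The estimate is a
locally absolutely continuous (Carathéodory) solution of its differential equation, since `Proj`
is discontinuous at the boundary of `Ω`. -/
structure IsAdaptiveLoop (Γc : ℝ) (x xhat θhat : ℝ → Fin n → ℝ) (u : ℝ → ℝ) : Prop where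
  plant : S.IsPlantSolution x u
  /-- `u = - Kᵀ x + u₂`, `u₂(s) = C(s) (r̄(s) + k_g r(s))`, `r̄ = θhatᵀ x` -/
  control : ∀ t, 0 ≤ t →
    u t = - (S.K ⬝ᵥ x t) + S.C.response (fun τ => θhat τ ⬝ᵥ x τ + S.kg * S.r τ) t
  predictor_init : xhat 0 = S.x₀
  /-- `d xhat / dt = A_m xhat - b θhatᵀ x + b u₂` -/
  predictor : ∀ t, 0 ≤ t → HasDerivWithinAt xhat
    (S.Am *ᵥ xhat t - (θhat t ⬝ᵥ x t) • S.b
      + (S.C.response (fun τ => θhat τ ⬝ᵥ x τ + S.kg * S.r τ) t) • S.b) (Ici 0) t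
  estimate_init : θhat 0 = S.θhat₀
  estimate_ac : ∀ T, 0 < T → AbsolutelyContinuousOnInterval θhat 0 T
  /-- `d θhat / dt = Γ_c Proj(θhat, x (xhat - x)ᵀ P b)` -/
  adaptation : ∀ᵐ t ∂(volume.restrict (Ici (0 : ℝ))), ∃ v : Fin n → ℝ,
    IsProj S.Ω (θhat t) (((xhat t - x t) ⬝ᵥ (S.P *ᵥ S.b)) • x t) v ∧
      HasDerivAt θhat (Γc • v) t

/-- The reference system: the plant in closed loop with the ideal controller
`u_ref(s) = C(s) (k_g r(s) + η(s)) - Kᵀ x_ref(s)`, `η = θᵀ x_ref`. -/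
structure IsReferenceLoop (xref : ℝ → Fin n → ℝ) (uref : ℝ → ℝ) : Prop where
  plant : S.IsPlantSolution xref uref
  control : ∀ t, 0 ≤ t →
    uref t = S.C.response (fun τ => S.kg * S.r τ + S.θ ⬝ᵥ xref τ) t - S.K ⬝ᵥ xref t

end Data

end L1Adaptive

end

/-!
With `z = xhat - x` and `ϑ = θhat - θ`, the function `Γc zᵀ P z + ϑᵀ ϑ` does not increase along the
adaptive loop: since `θ ∈ Ω`, projecting onto the tangent cone only helps. It starts at a value
independent of `Γc`, so `z = O(Γc ^ (-1/2))` uniformly in time.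

The mismatch `η = ϑᵀ x` drives `z` along `b`. As `C(s)` is strictly proper, integration by parts
expresses the filtered mismatch `C η` through `z`, so `C η = O(Γc ^ (-1/2))` too. The error
`e = x - xref` satisfies `e = Ḡ * (θᵀ e) + H_o * (C η)`, and `‖Ḡ‖ θ_max < 1` makes this a small-gain
inequality for `sup ‖e‖`. Finally `u - uref = C (θᵀ e) + C η - Kᵀ e`.
-/

namespace L1Adaptive

section MatrixExponential

variable {m : Type*} [Fintype m] [DecidableEq m]

theorem exp_smul_one (z : ℂ) :
    NormedSpace.exp (z • (1 : Matrix m m ℂ)) = Complex.exp z • (1 : Matrix m m ℂ) := by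
  rw [Matrix.smul_one_eq_diagonal, Matrix.exp_diagonal, Matrix.smul_one_eq_diagonal]
  congr 1
  ext i
  rw [Complex.exp_eq_exp_ℂ, Pi.coe_exp]

open scoped Matrix.Norms.Operator in
theorem exp_map_ofReal (A : Matrix m m ℝ) :
    (NormedSpace.exp A).map Complex.ofReal = NormedSpace.exp (A.map Complex.ofReal) :=
  NormedSpace.map_exp (Complex.ofRealHom.mapMatrix (m := m))
    (Continuous.matrix_map continuous_id Complex.continuous_ofReal) A

open scoped Matrix.Norms.Operator in
theorem hasSum_exp_mulVec (A : Matrix m m ℂ) (v : m → ℂ) :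
    HasSum (fun j : ℕ => ((j.factorial : ℂ)⁻¹) • (A ^ j *ᵥ v)) (NormedSpace.exp A *ᵥ v) := by
  have hcont : Continuous fun M : Matrix m m ℂ => M *ᵥ v :=
    Continuous.matrix_mulVec continuous_id continuous_const
  refine ((NormedSpace.exp_series_hasSum_exp' (𝕂 := ℂ) A).map
    ((Matrix.mulVecBilin ℂ ℂ).flip v) hcont).congr_fun fun j => ?_
  exact (Matrix.smul_mulVec _ _ v).symm

theorem exp_mulVec_of_pow_mulVec_eq_zero {N : Matrix m m ℂ} {k : ℕ} {v : m → ℂ}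
    (hv : N ^ k *ᵥ v = 0) :
    NormedSpace.exp N *ᵥ v =
      ∑ j ∈ Finset.range k, ((j.factorial : ℂ)⁻¹) • (N ^ j *ᵥ v) := by
  refine (hasSum_exp_mulVec N v).unique (hasSum_sum_of_ne_finset_zero fun j hj => ?_)
  obtain ⟨l, rfl⟩ := Nat.exists_eq_add_of_le' (not_lt.mp (Finset.mem_range.not.mp hj))
  rw [pow_add, ← Matrix.mulVec_mulVec, hv, Matrix.mulVec_zero, smul_zero]

theorem exp_smul_mulVec_of_pow_mulVec_eq_zero {B : Matrix m m ℂ} {z : ℂ} {k : ℕ} {v : m → ℂ}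
    (hv : (B - z • 1) ^ k *ᵥ v = 0) (t : ℂ) :
    NormedSpace.exp (t • B) *ᵥ v = Complex.exp (t * z) • ∑ j ∈ Finset.range k,
      ((j.factorial : ℂ)⁻¹ * t ^ j) • ((B - z • 1) ^ j *ᵥ v) := by
  have hB : t • B = (t * z) • (1 : Matrix m m ℂ) + t • (B - z • 1) := by
    rw [smul_sub, smul_smul]; abel
  have hcomm : Commute ((t * z) • (1 : Matrix m m ℂ)) (t • (B - z • 1)) :=
    (Commute.one_left _).smul_left _
  have hv' : (t • (B - z • 1)) ^ k *ᵥ v = 0 := by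
    rw [smul_pow, Matrix.smul_mulVec, hv, smul_zero]
  rw [hB, Matrix.exp_add_of_commute _ _ hcomm, exp_smul_one, smul_mul_assoc, one_mul,
    Matrix.smul_mulVec, exp_mulVec_of_pow_mulVec_eq_zero hv']
  simp only [smul_pow, Matrix.smul_mulVec, smul_smul]

theorem exp_mul_smul_isBigO {E : Type*} [NormedAddCommGroup E] [NormedSpace ℂ E] {z : ℂ} {α : ℝ}
    (hz : z.re < -α) (c : ℂ) (j : ℕ) (w : E) :
    (fun t : ℝ => (Complex.exp (t * z) * (c * t ^ j)) • w) =O[atTop]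
      fun t => Real.exp (-α * t) := by
  have hpow : (fun t : ℝ => t ^ j) =O[atTop] fun t => Real.exp ((-α - z.re) * t) :=
    (isLittleO_pow_exp_pos_mul_atTop j (by linarith)).isBigO
  have hmul : (fun t : ℝ => Real.exp (z.re * t) * t ^ j) =O[atTop]
      fun t => Real.exp (-α * t) := by
    refine ((Asymptotics.isBigO_refl (fun t : ℝ => Real.exp (z.re * t)) _).mul hpow).congr_right
      fun t => ?_
    rw [← Real.exp_add]; ring_nf
  refine Asymptotics.IsBigO.trans
    (Asymptotics.IsBigO.of_bound (‖c‖ * ‖w‖) (Eventually.of_forall fun t => le_of_eq ?_)) hmul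
  rw [norm_smul, norm_mul, norm_mul, Complex.norm_exp, norm_mul, Real.norm_eq_abs, Real.abs_exp,
    norm_pow, norm_pow, Complex.norm_real, Complex.re_ofReal_mul, mul_comm t]
  ring

theorem exp_smul_mulVec_isBigO {B : Matrix m m ℂ} {α : ℝ}
    (hB : ∀ z ∈ spectrum ℂ B, z.re < -α) (v : m → ℂ) :
    (fun t : ℝ => NormedSpace.exp ((t : ℂ) • B) *ᵥ v) =O[atTop] fun t => Real.exp (-α * t) := by
  have hv : v ∈ ⨆ z : ℂ, Module.End.maxGenEigenspace (Matrix.toLin' B) z := by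
    rw [Module.End.iSup_maxGenEigenspace_eq_top]; trivial
  induction hv using Submodule.iSup_induction' with
  | mem z w hw =>
    obtain ⟨k, hk⟩ := Module.End.mem_maxGenEigenspace _ _ _ |>.mp hw
    replace hk : (B - z • 1) ^ k *ᵥ w = 0 := by
      rw [← Matrix.toLin'_apply, Matrix.toLin'_pow, map_sub, map_smul, Matrix.toLin'_one]
      exact hk
    by_cases hz : z ∈ spectrum ℂ B
    · simp_rw [exp_smul_mulVec_of_pow_mulVec_eq_zero hk, Finset.smul_sum, smul_smul]
      exact Asymptotics.IsBigO.fun_sum fun j _ => exp_mul_smul_isBigO (hB z hz) _ j _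
    · have hu : IsUnit (B - z • 1) := by
        simpa only [neg_sub, Algebra.algebraMap_eq_smul_one] using (spectrum.notMem_iff.mp hz).neg
      obtain rfl : w = 0 :=
        Matrix.mulVec_injective_of_isUnit (hu.pow k) (by rw [hk, Matrix.mulVec_zero])
      simp_rw [Matrix.mulVec_zero]
      exact Asymptotics.isBigO_zero _ _
  | zero =>
    simp_rw [Matrix.mulVec_zero]
    exact Asymptotics.isBigO_zero _ _
  | add x y _ _ hx hy => simpa only [Matrix.mulVec_add] using hx.add hy

end MatrixExponential

section ImpulseResponse

variable {n : ℕ}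

open scoped Matrix.Norms.Operator in
theorem hasDerivAt_stateImpulse (A : Matrix (Fin n) (Fin n) ℝ) (v : Fin n → ℝ) (t : ℝ) :
    HasDerivAt (stateImpulse A v) (A *ᵥ stateImpulse A v t) t := by
  let L : Matrix (Fin n) (Fin n) ℝ →L[ℝ] (Fin n → ℝ) :=
    LinearMap.toContinuousLinearMap ((Matrix.mulVecBilin ℝ ℝ).flip v)
  rw [stateImpulse, Matrix.mulVec_mulVec]
  exact L.hasFDerivAt.comp_hasDerivAt t (hasDerivAt_exp_smul_const' A t)

theorem mulVec_stateImpulse (A : Matrix (Fin n) (Fin n) ℝ) (v : Fin n → ℝ) (t : ℝ) :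
    A *ᵥ stateImpulse A v t = stateImpulse A (A *ᵥ v) t := by
  have hcomm : Commute A (NormedSpace.exp (t • A)) := ((Commute.refl A).smul_right t).exp_right
  rw [stateImpulse, stateImpulse, Matrix.mulVec_mulVec, Matrix.mulVec_mulVec, hcomm.eq]

theorem stateImpulse_zero (A : Matrix (Fin n) (Fin n) ℝ) (v : Fin n → ℝ) :
    stateImpulse A v 0 = v := by
  rw [stateImpulse, zero_smul, NormedSpace.exp_zero, Matrix.one_mulVec]

theorem dotProduct_stateImpulse (A : Matrix (Fin n) (Fin n) ℝ) (d v : Fin n → ℝ) (t : ℝ) :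
    d ⬝ᵥ stateImpulse A v t = stateImpulse Aᵀ d t ⬝ᵥ v := by
  rw [stateImpulse, stateImpulse, ← Matrix.transpose_smul, Matrix.exp_transpose,
    Matrix.mulVec_transpose, Matrix.dotProduct_mulVec]

theorem continuous_stateImpulse (A : Matrix (Fin n) (Fin n) ℝ) (v : Fin n → ℝ) :
    Continuous (stateImpulse A v) :=
  continuous_iff_continuousAt.2 fun t => (hasDerivAt_stateImpulse A v t).continuousAt

theorem continuous_dotProduct_stateImpulse (A : Matrix (Fin n) (Fin n) ℝ) (d v : Fin n → ℝ) :
    Continuous fun t => d ⬝ᵥ stateImpulse A v t :=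
  continuous_const.dotProduct (continuous_stateImpulse A v)

theorem norm_ofReal_comp {ι : Type*} [Fintype ι] (v : ι → ℝ) : ‖fun i => (v i : ℂ)‖ = ‖v‖ := by
  simp only [Pi.norm_def, Complex.nnnorm_real]

theorem stateImpulse_ofReal (A : Matrix (Fin n) (Fin n) ℝ) (v : Fin n → ℝ) (t : ℝ) :
    (fun i => (stateImpulse A v t i : ℂ)) =
      NormedSpace.exp ((t : ℂ) • A.map Complex.ofReal) *ᵥ fun i => (v i : ℂ) := by
  have hmap : (t : ℂ) • A.map Complex.ofReal = (t • A).map Complex.ofReal := by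
    ext i j
    simp only [Matrix.smul_apply, Matrix.map_apply, smul_eq_mul, Complex.ofReal_mul]
  rw [hmap, ← exp_map_ofReal]
  ext i
  simp only [stateImpulse, Matrix.mulVec, dotProduct, Matrix.map_apply, Complex.ofReal_sum,
    Complex.ofReal_mul]

namespace IsHurwitz

variable {A : Matrix (Fin n) (Fin n) ℝ}

theorem exists_re_lt_neg (hA : IsHurwitz A) :
    ∃ α > 0, ∀ z ∈ spectrum ℂ (A.map Complex.ofReal), z.re < -α := by
  have hev : ∀ᶠ α in 𝓝[>] (0 : ℝ), ∀ z ∈ spectrum ℂ (A.map Complex.ofReal), z.re < -α := by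
    rw [eventually_all_finite (Matrix.finite_spectrum _)]
    intro z hz
    filter_upwards [nhdsWithin_le_nhds (Iio_mem_nhds (neg_pos.mpr (hA z hz)))] with α hα
    exact lt_neg_of_lt_neg hα
  obtain ⟨α, hα, hpos⟩ := (hev.and self_mem_nhdsWithin).exists
  exact ⟨α, hpos, hα⟩

theorem exists_stateImpulse_isBigO (hA : IsHurwitz A) :
    ∃ α > 0, ∀ v, stateImpulse A v =O[atTop] fun t => Real.exp (-α * t) := by
  obtain ⟨α, hα, hspec⟩ := hA.exists_re_lt_neg
  refine ⟨α, hα, fun v => ?_⟩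
  have hO := (exp_smul_mulVec_isBigO hspec fun i => (v i : ℂ)).norm_left
  simp only [← stateImpulse_ofReal, norm_ofReal_comp] at hO
  exact hO.of_norm_left

theorem dotProduct_stateImpulse_isBigO (hA : IsHurwitz A) (d v : Fin n → ℝ) :
    ∃ α > 0, (fun t => d ⬝ᵥ stateImpulse A v t) =O[atTop] fun t => Real.exp (-α * t) := by
  obtain ⟨α, hα, hO⟩ := hA.exists_stateImpulse_isBigO
  exact ⟨α, hα, Asymptotics.IsBigO.fun_sum fun i _ =>
    (Asymptotics.isBigO_pi.mp (hO v) i).const_mul_left (d i)⟩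

theorem integrableOn_dotProduct_stateImpulse (hA : IsHurwitz A) (d v : Fin n → ℝ) :
    IntegrableOn (fun t => d ⬝ᵥ stateImpulse A v t) (Ioi 0) := by
  obtain ⟨α, hα, hO⟩ := hA.dotProduct_stateImpulse_isBigO d v
  exact integrable_of_isBigO_exp_neg hα
    (continuous_dotProduct_stateImpulse A d v).continuousOn hO

theorem tendsto_stateImpulse (hA : IsHurwitz A) (v : Fin n → ℝ) :
    Tendsto (stateImpulse A v) atTop (𝓝 0) := by
  obtain ⟨α, hα, hO⟩ := hA.exists_stateImpulse_isBigO
  refine (hO v).trans_tendsto (Real.tendsto_exp_atBot.comp ?_)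
  exact tendsto_id.const_mul_atTop_of_neg (neg_neg_of_pos hα)

end IsHurwitz

end ImpulseResponse

section Triangle

variable {E : Type*} [NormedAddCommGroup E] [NormedSpace ℝ E]

theorem integral_Ioc_indicator_Iic {a b τ : ℝ} (hτ : τ ∈ Icc a b) (f : ℝ → E) :
    ∫ s in a..b, (Iic τ).indicator f s = ∫ s in a..τ, f s := by
  rw [intervalIntegral.integral_of_le (hτ.1.trans hτ.2), intervalIntegral.integral_of_le hτ.1,
    setIntegral_indicator measurableSet_Iic, Ioc_inter_Iic, min_eq_right hτ.2]

theorem integral_Ioc_indicator_Ici {a b s : ℝ} (hs : s ∈ Ioc a b) (f : ℝ → E) :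
    ∫ τ in a..b, (Ici s).indicator f τ = ∫ τ in s..b, f τ := by
  have hinter : Ioc a b ∩ Ici s = Icc s b := by
    ext τ
    exact ⟨fun h => ⟨h.2, h.1.2⟩, fun h => ⟨⟨hs.1.trans_le h.1, h.2⟩, h.1⟩⟩
  rw [intervalIntegral.integral_of_le (hs.1.le.trans hs.2), intervalIntegral.integral_of_le hs.2,
    setIntegral_indicator measurableSet_Ici, hinter, integral_Icc_eq_integral_Ioc]

theorem intervalIntegral_triangle_swap {F : ℝ → ℝ → E} {a b : ℝ} (hab : a ≤ b)
    (hF : IntegrableOn (Function.uncurry F) (Ioc a b ×ˢ Ioc a b)) :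
    ∫ τ in a..b, ∫ s in a..τ, F τ s = ∫ s in a..b, ∫ τ in s..b, F τ s := by
  have hT : MeasurableSet {p : ℝ × ℝ | p.2 ≤ p.1} := measurableSet_le measurable_snd measurable_fst
  have hint : IntegrableOn (Function.uncurry fun τ s => (Iic τ).indicator (F τ) s)
      (uIoc a b ×ˢ uIoc a b) := by
    rw [uIoc_of_le hab]
    exact hF.indicator hT
  calc ∫ τ in a..b, ∫ s in a..τ, F τ s
      = ∫ τ in a..b, ∫ s in a..b, (Iic τ).indicator (F τ) s := by
        refine intervalIntegral.integral_congr fun τ hτ => ?_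
        rw [uIcc_of_le hab] at hτ
        exact (integral_Ioc_indicator_Iic hτ (F τ)).symm
    _ = ∫ s in a..b, ∫ τ in a..b, (Ici s).indicator (fun τ => F τ s) τ :=
        intervalIntegral_intervalIntegral_swap hint
    _ = ∫ s in a..b, ∫ τ in s..b, F τ s := by
        refine intervalIntegral.integral_congr_ae (Eventually.of_forall fun s hs => ?_)
        rw [uIoc_of_le hab] at hs
        exact integral_Ioc_indicator_Ici hs _

end Triangle

section CausalConvolution

/-- The convolution of `k` and `w` as signals on `[0, ∞)`: the response to the input `w` of a
system with impulse response `k` starting from rest. Only the values of `k` and `w` on `[0, t]`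
enter. -/
noncomputable def causalConv (k w : ℝ → ℝ) (t : ℝ) : ℝ := ∫ τ in (0 : ℝ)..t, k (t - τ) * w τ

variable {h k k' w w₁ w₂ : ℝ → ℝ} {t : ℝ}

theorem causalConv_congr (ht : 0 ≤ t) (hw : ∀ τ ∈ Icc 0 t, w₁ τ = w₂ τ) :
    causalConv k w₁ t = causalConv k w₂ t := by
  refine intervalIntegral.integral_congr fun τ hτ => ?_
  rw [uIcc_of_le ht] at hτ
  simp only [hw τ hτ]

theorem intervalIntegrable_causalConv (hk : Continuous k) (hw : IntervalIntegrable w volume 0 t) :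
    IntervalIntegrable (fun τ => k (t - τ) * w τ) volume 0 t :=
  hw.continuousOn_mul (hk.comp (continuous_sub_left t)).continuousOn

theorem causalConv_add (hk : Continuous k) (hw₁ : IntervalIntegrable w₁ volume 0 t)
    (hw₂ : IntervalIntegrable w₂ volume 0 t) :
    causalConv k (fun τ => w₁ τ + w₂ τ) t = causalConv k w₁ t + causalConv k w₂ t := by
  simp only [causalConv, mul_add]
  exact intervalIntegral.integral_add (intervalIntegrable_causalConv hk hw₁)
    (intervalIntegrable_causalConv hk hw₂)

theorem causalConv_const_mul (c : ℝ) :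
    causalConv k (fun τ => c * w τ) t = c * causalConv k w t := by
  simp only [causalConv, mul_left_comm _ c, intervalIntegral.integral_const_mul]

theorem causalConv_sub (hk : Continuous k) (hw₁ : IntervalIntegrable w₁ volume 0 t)
    (hw₂ : IntervalIntegrable w₂ volume 0 t) :
    causalConv k (fun τ => w₁ τ - w₂ τ) t = causalConv k w₁ t - causalConv k w₂ t := by
  simp only [causalConv, mul_sub]
  exact intervalIntegral.integral_sub (intervalIntegrable_causalConv hk hw₁)
    (intervalIntegrable_causalConv hk hw₂)

theorem causalConv_sub_left (hh : Continuous h) (hk : Continuous k)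
    (hw : IntervalIntegrable w volume 0 t) :
    causalConv (fun s => h s - k s) w t = causalConv h w t - causalConv k w t := by
  simp only [causalConv, sub_mul]
  exact intervalIntegral.integral_sub (intervalIntegrable_causalConv hh hw)
    (intervalIntegrable_causalConv hk hw)

theorem continuous_causalConv (hk : Continuous k) (hw : Continuous w) :
    Continuous (causalConv k w) :=
  intervalIntegral.continuous_parametric_intervalIntegral_of_continuous
    (f := fun t τ => k (t - τ) * w τ) (by fun_prop) continuous_id

theorem continuousOn_causalConv (hk : Continuous k) (hw : ContinuousOn w (Ici 0)) :
    ContinuousOn (causalConv k w) (Ici 0) := by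
  have hw' : Continuous fun t => w (max 0 t) :=
    hw.comp_continuous (by fun_prop) fun t => le_max_left 0 t
  refine (continuous_causalConv hk hw').continuousOn.congr fun t ht =>
    causalConv_congr ht fun τ hτ => ?_
  rw [max_eq_right hτ.1]

theorem abs_causalConv_le {W : ℝ} (hk : Continuous k) (ht : 0 ≤ t)
    (hw : ∀ τ ∈ Icc 0 t, |w τ| ≤ W) :
    |causalConv k w t| ≤ (∫ τ in (0 : ℝ)..t, |k τ|) * W := by
  have hsub : (∫ τ in (0 : ℝ)..t, |k τ|) * W = ∫ τ in (0 : ℝ)..t, |k (t - τ)| * W := by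
    rw [intervalIntegral.integral_mul_const,
      intervalIntegral.integral_comp_sub_left (fun τ => |k τ|) t, sub_self, sub_zero]
  have hint : IntervalIntegrable (fun τ => |k (t - τ)| * W) volume 0 t :=
    Continuous.intervalIntegrable (by fun_prop) _ _
  rw [hsub, ← Real.norm_eq_abs]
  refine intervalIntegral.norm_integral_le_of_norm_le ht (Eventually.of_forall fun τ hτ => ?_) hint
  rw [Real.norm_eq_abs, abs_mul]
  exact mul_le_mul_of_nonneg_left (hw τ (Ioc_subset_Icc_self hτ)) (abs_nonneg _)

theorem abs_causalConv_le_of_integrableOn {W : ℝ} (hk : Continuous k)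
    (hki : IntegrableOn k (Ioi 0)) (ht : 0 ≤ t) (hw : ∀ τ ∈ Icc 0 t, |w τ| ≤ W) :
    |causalConv k w t| ≤ (∫ τ in Ioi (0 : ℝ), |k τ|) * W := by
  have hW : 0 ≤ W := (abs_nonneg _).trans (hw 0 (left_mem_Icc.mpr ht))
  refine (abs_causalConv_le hk ht hw).trans (mul_le_mul_of_nonneg_right ?_ hW)
  rw [intervalIntegral.integral_of_le ht]
  exact setIntegral_mono_set hki.abs (Eventually.of_forall fun τ => abs_nonneg _)
    Ioc_subset_Ioi_self.eventuallyLE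

theorem causalConv_assoc (hh : Continuous h) (hk : Continuous k) (ht : 0 ≤ t)
    (hw : ContinuousOn w (Icc 0 t)) :
    causalConv h (causalConv k w) t = causalConv (causalConv h k) w t := by
  have hF : IntegrableOn (Function.uncurry fun τ s => h (t - τ) * (k (τ - s) * w s))
      (Ioc 0 t ×ˢ Ioc 0 t) := by
    have hcont : ContinuousOn (Function.uncurry fun τ s => h (t - τ) * (k (τ - s) * w s))
        (Icc 0 t ×ˢ Icc 0 t) :=
      (by fun_prop : Continuous fun p : ℝ × ℝ => h (t - p.1)).continuousOn.mul
        ((by fun_prop : Continuous fun p : ℝ × ℝ => k (p.1 - p.2)).continuousOn.mul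
          (hw.comp continuousOn_snd fun p hp => hp.2))
    exact (hcont.integrableOn_compact (isCompact_Icc.prod isCompact_Icc)).mono_set
      (prod_mono Ioc_subset_Icc_self Ioc_subset_Icc_self)
  calc causalConv h (causalConv k w) t
      = ∫ τ in (0 : ℝ)..t, ∫ s in (0 : ℝ)..τ, h (t - τ) * (k (τ - s) * w s) := by
        simp only [causalConv, intervalIntegral.integral_const_mul]
    _ = ∫ s in (0 : ℝ)..t, ∫ τ in s..t, h (t - τ) * (k (τ - s) * w s) :=
        intervalIntegral_triangle_swap ht hF
    _ = causalConv (causalConv h k) w t := by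
        refine intervalIntegral.integral_congr fun s _ => ?_
        have hshift := intervalIntegral.integral_comp_sub_right (a := s) (b := t)
          (fun σ => h (t - s - σ) * k σ * w s) s
        simp only [sub_self, sub_sub_sub_cancel_right,
          intervalIntegral.integral_mul_const] at hshift
        simp only [causalConv, ← hshift, ← mul_assoc, intervalIntegral.integral_mul_const]

theorem integral_eq_sub_of_hasDerivWithinAt_Ici {f f' : ℝ → ℝ}
    (hf : ∀ τ, 0 ≤ τ → HasDerivWithinAt f (f' τ) (Ici 0) τ) (ht : 0 ≤ t)
    (hf' : IntervalIntegrable f' volume 0 t) : ∫ τ in (0 : ℝ)..t, f' τ = f t - f 0 :=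
  intervalIntegral.integral_eq_sub_of_hasDerivAt_of_le ht
    (fun τ hτ => (hf τ hτ.1).continuousWithinAt.mono Icc_subset_Ici_self)
    (fun τ hτ => (hf τ hτ.1.le).hasDerivAt (Ici_mem_nhds hτ.1)) hf'

theorem causalConv_deriv {φ φ' : ℝ → ℝ} (hk : ∀ s, HasDerivAt k (k' s) s) (hk' : Continuous k')
    (hφ : ∀ τ, 0 ≤ τ → HasDerivWithinAt φ (φ' τ) (Ici 0) τ) (hφ₀ : φ 0 = 0) (ht : 0 ≤ t)
    (hφ' : IntervalIntegrable φ' volume 0 t) :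
    causalConv k φ' t = k 0 * φ t + causalConv k' φ t := by
  have hkc : Continuous k := continuous_iff_continuousAt.2 fun s => (hk s).continuousAt
  have hφi : IntervalIntegrable φ volume 0 t :=
    ContinuousOn.intervalIntegrable_of_Icc ht fun τ hτ =>
      (hφ τ hτ.1).continuousWithinAt.mono Icc_subset_Ici_self
  have hderiv : ∀ τ, 0 ≤ τ → HasDerivWithinAt (fun τ => k (t - τ) * φ τ)
      (k (t - τ) * φ' τ - k' (t - τ) * φ τ) (Ici 0) τ := fun τ hτ =>
    (((hk (t - τ)).comp_const_sub t τ).hasDerivWithinAt.mul (hφ τ hτ)).congr_deriv (by ring)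
  have hk'φ := intervalIntegrable_causalConv hk' hφi
  have hkφ' := intervalIntegrable_causalConv hkc hφ'
  have hftc := integral_eq_sub_of_hasDerivWithinAt_Ici hderiv ht (hkφ'.sub hk'φ)
  rw [intervalIntegral.integral_sub hkφ' hk'φ, hφ₀, sub_self, mul_zero, sub_zero] at hftc
  exact sub_eq_iff_eq_add.mp hftc

end CausalConvolution

section LinearSystem

theorem hasDerivWithinAt_dotProduct {ι : Type*} [Fintype ι] {f g : ℝ → ι → ℝ} {f' g' : ι → ℝ}
    {s : Set ℝ} {t : ℝ} (hf : HasDerivWithinAt f f' s t) (hg : HasDerivWithinAt g g' s t) :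
    HasDerivWithinAt (fun τ => f τ ⬝ᵥ g τ) (f' ⬝ᵥ g t + f t ⬝ᵥ g') s t :=
  (HasDerivWithinAt.fun_sum (u := Finset.univ) fun i _ =>
    (hasDerivWithinAt_pi.mp hf i).mul (hasDerivWithinAt_pi.mp hg i)).congr_deriv
      Finset.sum_add_distrib

theorem hasDerivWithinAt_const_dotProduct {ι : Type*} [Fintype ι] (d : ι → ℝ) {f : ℝ → ι → ℝ}
    {f' : ι → ℝ} {s : Set ℝ} {t : ℝ} (hf : HasDerivWithinAt f f' s t) :
    HasDerivWithinAt (fun τ => d ⬝ᵥ f τ) (d ⬝ᵥ f') s t :=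
  (hasDerivWithinAt_dotProduct (hasDerivWithinAt_const t s d) hf).congr_deriv
    (by rw [zero_dotProduct, zero_add])

theorem continuousOn_dotProduct {ι : Type*} [Fintype ι] {f g : ℝ → ι → ℝ} {s : Set ℝ}
    (hf : ContinuousOn f s) (hg : ContinuousOn g s) : ContinuousOn (fun τ => f τ ⬝ᵥ g τ) s :=
  continuousOn_finsetSum _ fun i _ => (continuousOn_pi.mp hf i).mul (continuousOn_pi.mp hg i)

theorem abs_dotProduct_le {ι : Type*} [Fintype ι] (d x : ι → ℝ) :
    |d ⬝ᵥ x| ≤ (∑ i, |d i|) * ‖x‖ := by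
  rw [dotProduct, Finset.sum_mul]
  refine (Finset.abs_sum_le_sum_abs _ _).trans (Finset.sum_le_sum fun i _ => ?_)
  rw [abs_mul]
  exact mul_le_mul_of_nonneg_left (norm_le_pi_norm x i) (abs_nonneg _)

theorem abs_dotProduct_le_of_norm_le {ι : Type*} [Fintype ι] (d : ι → ℝ) {x : ι → ℝ} {X : ℝ}
    (hx : ‖x‖ ≤ X) : |d ⬝ᵥ x| ≤ (∑ i, |d i|) * X :=
  (abs_dotProduct_le d x).trans
    (mul_le_mul_of_nonneg_left hx (Finset.sum_nonneg fun _ _ => abs_nonneg _))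

variable {n : ℕ} {A : Matrix (Fin n) (Fin n) ℝ} {b : Fin n → ℝ}

theorem dotProduct_eq_causalConv_of_hasDerivWithinAt {e : ℝ → Fin n → ℝ} {v : ℝ → ℝ}
    (he₀ : e 0 = 0)
    (he : ∀ τ, 0 ≤ τ → HasDerivWithinAt e (A *ᵥ e τ + v τ • b) (Ici 0) τ) (d : Fin n → ℝ) {t : ℝ}
    (ht : 0 ≤ t) (hv : IntervalIntegrable v volume 0 t) :
    d ⬝ᵥ e t = causalConv (fun s => d ⬝ᵥ stateImpulse A b s) v t := by
  have hderiv : ∀ τ, 0 ≤ τ → HasDerivWithinAt (fun τ => stateImpulse Aᵀ d (t - τ) ⬝ᵥ e τ)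
      (d ⬝ᵥ stateImpulse A b (t - τ) * v τ) (Ici 0) τ := fun τ hτ => by
    refine (hasDerivWithinAt_dotProduct ((hasDerivAt_stateImpulse Aᵀ d (t - τ)).comp_const_sub
      t τ).hasDerivWithinAt (he τ hτ)).congr_deriv ?_
    rw [neg_dotProduct, Matrix.mulVec_transpose, ← Matrix.dotProduct_mulVec, dotProduct_add,
      neg_add_cancel_left, dotProduct_smul, smul_eq_mul, mul_comm, dotProduct_stateImpulse]
  have hint := intervalIntegrable_causalConv (continuous_dotProduct_stateImpulse A d b) hv
  have hftc := integral_eq_sub_of_hasDerivWithinAt_Ici hderiv ht hint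
  rw [sub_self, stateImpulse_zero, he₀, dotProduct_zero, sub_zero] at hftc
  exact hftc.symm

theorem apply_eq_causalConv_of_hasDerivWithinAt {e : ℝ → Fin n → ℝ} {v : ℝ → ℝ}
    (he₀ : e 0 = 0)
    (he : ∀ τ, 0 ≤ τ → HasDerivWithinAt e (A *ᵥ e τ + v τ • b) (Ici 0) τ) {t : ℝ}
    (ht : 0 ≤ t) (hv : IntervalIntegrable v volume 0 t) (i : Fin n) :
    e t i = causalConv (fun s => stateImpulse A b s i) v t := by
  simpa only [single_one_dotProduct] using
    dotProduct_eq_causalConv_of_hasDerivWithinAt he₀ he (Pi.single i 1) ht hv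

theorem continuous_stateImpulse_apply (A : Matrix (Fin n) (Fin n) ℝ) (b : Fin n → ℝ) (i : Fin n) :
    Continuous fun s => stateImpulse A b s i :=
  (continuous_apply i).comp (continuous_stateImpulse A b)

theorem IsHurwitz.integrableOn_stateImpulse_apply (hA : IsHurwitz A) (b : Fin n → ℝ) (i : Fin n) :
    IntegrableOn (fun s => stateImpulse A b s i) (Ioi 0) := by
  simpa only [single_one_dotProduct] using
    hA.integrableOn_dotProduct_stateImpulse (Pi.single i 1) b

theorem IsHurwitz.exists_norm_causalConv_le (hA : IsHurwitz A) (b : Fin n → ℝ) :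
    ∃ κ ≥ 0, ∀ (w : ℝ → ℝ) (W t : ℝ), 0 ≤ t → (∀ τ ∈ Icc 0 t, |w τ| ≤ W) →
      ‖fun i => causalConv (fun s => stateImpulse A b s i) w t‖ ≤ κ * W := by
  have hnonneg : ∀ i, 0 ≤ ∫ s in Ioi (0 : ℝ), |stateImpulse A b s i| := fun i =>
    integral_nonneg fun _ => abs_nonneg _
  refine ⟨∑ i, ∫ s in Ioi (0 : ℝ), |stateImpulse A b s i|,
    Finset.sum_nonneg fun i _ => hnonneg i, fun w W t ht hw => ?_⟩
  have hW : 0 ≤ W := (abs_nonneg _).trans (hw 0 (left_mem_Icc.mpr ht))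
  refine (pi_norm_le_iff_of_nonneg (mul_nonneg (Finset.sum_nonneg fun i _ => hnonneg i) hW)).mpr
    fun i => ?_
  refine (abs_causalConv_le_of_integrableOn (continuous_stateImpulse_apply A b i)
    (hA.integrableOn_stateImpulse_apply b i) ht hw).trans (mul_le_mul_of_nonneg_right ?_ hW)
  exact Finset.single_le_sum (fun j _ => hnonneg j) (Finset.mem_univ i)

end LinearSystem

namespace StrictlyProperSystem

variable (C : StrictlyProperSystem)

theorem continuous_impulse : Continuous C.impulse :=
  continuous_dotProduct_stateImpulse C.A C.c C.b

theorem hasDerivAt_impulse (s : ℝ) :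
    HasDerivAt C.impulse (C.c ⬝ᵥ stateImpulse C.A (C.A *ᵥ C.b) s) s := by
  have hderiv := hasDerivWithinAt_const_dotProduct C.c
    (hasDerivAt_stateImpulse C.A C.b s).hasDerivWithinAt (s := univ)
  rwa [mulVec_stateImpulse, hasDerivWithinAt_univ] at hderiv

theorem response_eq_causalConv (v : ℝ → ℝ) : C.response v = causalConv C.impulse v := rfl

variable {C}

theorem IsStable.exists_abs_response_le (hC : C.IsStable) :
    ∃ κ ≥ 0, ∀ (v : ℝ → ℝ) (W t : ℝ), 0 ≤ t → (∀ τ ∈ Icc 0 t, |v τ| ≤ W) →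
      |C.response v t| ≤ κ * W :=
  ⟨∫ s in Ioi (0 : ℝ), |C.impulse s|, integral_nonneg fun _ => abs_nonneg _, fun _ _ _ ht hv =>
    abs_causalConv_le_of_integrableOn C.continuous_impulse
      (IsHurwitz.integrableOn_dotProduct_stateImpulse hC C.c C.b) ht hv⟩

variable {n : ℕ} {A : Matrix (Fin n) (Fin n) ℝ} {b : Fin n → ℝ}

theorem dotProduct_mul_response_eq {z : ℝ → Fin n → ℝ} {η : ℝ → ℝ} (hz₀ : z 0 = 0)
    (hz : ∀ τ, 0 ≤ τ → HasDerivWithinAt z (A *ᵥ z τ - η τ • b) (Ici 0) τ) (d : Fin n → ℝ)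
    {t : ℝ} (ht : 0 ≤ t) (hη : IntervalIntegrable η volume 0 t) :
    d ⬝ᵥ b * C.response η t = causalConv C.impulse (fun τ => (d ᵥ* A) ⬝ᵥ z τ) t
      - (C.impulse 0 * (d ⬝ᵥ z t)
        + causalConv (fun s => C.c ⬝ᵥ stateImpulse C.A (C.A *ᵥ C.b) s)
            (fun τ => d ⬝ᵥ z τ) t) := by
  have hzc : ContinuousOn z (Icc 0 t) := fun τ hτ =>
    (hz τ hτ.1).continuousWithinAt.mono Icc_subset_Ici_self
  have hdA : IntervalIntegrable (fun τ => (d ᵥ* A) ⬝ᵥ z τ) volume 0 t :=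
    (continuousOn_dotProduct continuousOn_const hzc).intervalIntegrable_of_Icc ht
  have hdz : ∀ τ, 0 ≤ τ → HasDerivWithinAt (fun τ => d ⬝ᵥ z τ)
      ((d ᵥ* A) ⬝ᵥ z τ - d ⬝ᵥ b * η τ) (Ici 0) τ := fun τ hτ => by
    refine (hasDerivWithinAt_const_dotProduct d (hz τ hτ)).congr_deriv ?_
    rw [dotProduct_sub, Matrix.dotProduct_mulVec, dotProduct_smul, smul_eq_mul, mul_comm]
  have hparts := causalConv_deriv C.hasDerivAt_impulse
    (continuous_dotProduct_stateImpulse C.A C.c (C.A *ᵥ C.b)) hdz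
    (by rw [hz₀, dotProduct_zero]) ht (hdA.sub (hη.const_mul _))
  rw [causalConv_sub C.continuous_impulse hdA (hη.const_mul _), causalConv_const_mul] at hparts
  rw [← hparts, sub_sub_cancel, response_eq_causalConv]

-- `η` itself need not be small when `z` is: only the filtered signal is, because the smoothness of
-- the impulse response lets `b ⬝ᵥ z` be differentiated inside the convolution.
theorem IsStable.exists_abs_response_le_of_state (hC : C.IsStable) (A : Matrix (Fin n) (Fin n) ℝ)
    (hb : b ≠ 0) :
    ∃ κ ≥ 0, ∀ (z : ℝ → Fin n → ℝ) (η : ℝ → ℝ) (X t : ℝ), z 0 = 0 →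
      (∀ τ, 0 ≤ τ → HasDerivWithinAt z (A *ᵥ z τ - η τ • b) (Ici 0) τ) →
      0 ≤ t → IntervalIntegrable η volume 0 t → (∀ τ ∈ Icc 0 t, ‖z τ‖ ≤ X) →
      |C.response η t| ≤ κ * X := by
  have hβ : 0 < b ⬝ᵥ b := by simpa only [star_trivial] using dotProduct_star_self_pos_iff.mpr hb
  have hk' := IsHurwitz.integrableOn_dotProduct_stateImpulse hC C.c (C.A *ᵥ C.b)
  obtain ⟨κ, hκ, hresp⟩ := hC.exists_abs_response_le
  set κ' := ∫ s in Ioi (0 : ℝ), |C.c ⬝ᵥ stateImpulse C.A (C.A *ᵥ C.b) s|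
  have : 0 ≤ κ' := integral_nonneg fun _ => abs_nonneg _
  set D := ∑ i, |b i|
  set D' := ∑ i, |(b ᵥ* A) i|
  refine ⟨(b ⬝ᵥ b)⁻¹ * (κ * D' + (|C.impulse 0| * D + κ' * D)), by positivity,
    fun z η X t hz₀ hz ht hη hX => ?_⟩
  have hbA := hresp _ _ t ht fun τ hτ => abs_dotProduct_le_of_norm_le (b ᵥ* A) (hX τ hτ)
  have hbz : ∀ τ ∈ Icc 0 t, |b ⬝ᵥ z τ| ≤ D * X := fun τ hτ =>
    abs_dotProduct_le_of_norm_le b (hX τ hτ)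
  calc |C.response η t| = (b ⬝ᵥ b)⁻¹ * |b ⬝ᵥ b * C.response η t| := by
        rw [abs_mul, abs_of_pos hβ, inv_mul_cancel_left₀ hβ.ne']
    _ ≤ (b ⬝ᵥ b)⁻¹ * (κ * (D' * X) + (|C.impulse 0| * (D * X) + κ' * (D * X))) := by
        rw [dotProduct_mul_response_eq hz₀ hz b ht hη]
        refine mul_le_mul_of_nonneg_left ?_ (inv_nonneg.mpr hβ.le)
        refine (abs_sub _ _).trans (add_le_add hbA ((abs_add_le _ _).trans (add_le_add ?_ ?_)))
        · rw [abs_mul]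
          exact mul_le_mul_of_nonneg_left (hbz t (right_mem_Icc.mpr ht)) (abs_nonneg _)
        · exact abs_causalConv_le_of_integrableOn
            (continuous_dotProduct_stateImpulse C.A C.c _) hk' ht hbz
    _ = (b ⬝ᵥ b)⁻¹ * (κ * D' + (|C.impulse 0| * D + κ' * D)) * X := by ring

end StrictlyProperSystem

section SmallGain

variable {n : ℕ} {g : ℝ → Fin n → ℝ}

theorem ofReal_integral_abs_le_l1Gain (g : ℝ → Fin n → ℝ) {i : Fin n} {t : ℝ}
    (hg : IntervalIntegrable (fun s => g s i) volume 0 t) (ht : 0 ≤ t) :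
    ENNReal.ofReal (∫ s in (0 : ℝ)..t, |g s i|) ≤ l1Gain g := by
  rw [intervalIntegral.integral_of_le ht, ofReal_integral_eq_lintegral_ofReal hg.abs.1
    (Eventually.of_forall fun _ => abs_nonneg _)]
  exact (lintegral_mono_set Ioc_subset_Ioi_self).trans
    (le_iSup (fun i => ∫⁻ s in Ioi (0 : ℝ), ENNReal.ofReal |g s i|) i)

theorem norm_causalConv_le_of_l1Gain (hg : ∀ i, Continuous fun s => g s i) {M : ℝ}
    (hgain : l1Gain g * ENNReal.ofReal M < ⊤) {w : ℝ → ℝ} {W t : ℝ} (ht : 0 ≤ t) (hW : 0 ≤ W)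
    (hw : ∀ τ ∈ Icc 0 t, |w τ| ≤ M * W) :
    ‖fun i => causalConv (fun s => g s i) w t‖
      ≤ (l1Gain g * ENNReal.ofReal M).toReal * W := by
  refine (pi_norm_le_iff_of_nonneg (mul_nonneg ENNReal.toReal_nonneg hW)).mpr fun i => ?_
  refine (abs_causalConv_le (hg i) ht hw).trans ?_
  rw [← mul_assoc]
  refine mul_le_mul_of_nonneg_right ?_ hW
  rw [← ENNReal.ofReal_le_iff_le_toReal hgain.ne,
    ENNReal.ofReal_mul (intervalIntegral.integral_nonneg ht fun _ _ => abs_nonneg _)]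
  exact mul_le_mul_left (ofReal_integral_abs_le_l1Gain g ((hg i).intervalIntegrable 0 t) ht) _

theorem exists_norm_le_of_small_gain (hg : ∀ i, Continuous fun s => g s i) {θ : Fin n → ℝ}
    (hgain : l1Gain g * ENNReal.ofReal (∑ i, |θ i|) < 1) :
    ∃ κ ≥ 0, ∀ (e : ℝ → Fin n → ℝ) (D t : ℝ), 0 ≤ t → ContinuousOn e (Icc 0 t) →
      (∀ s ∈ Icc 0 t, ‖fun i => e s i - causalConv (fun σ => g σ i) (fun τ => θ ⬝ᵥ e τ) s‖ ≤ D) →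
      ‖e t‖ ≤ κ * D := by
  set ρ := (l1Gain g * ENNReal.ofReal (∑ i, |θ i|)).toReal
  have hρ_lt : 0 < 1 - ρ := sub_pos.mpr (ENNReal.toReal_lt_of_lt_ofReal (by simpa using hgain))
  refine ⟨(1 - ρ)⁻¹, inv_nonneg.mpr hρ_lt.le, fun e D t ht he hD => ?_⟩
  obtain ⟨s, hs, hmax⟩ := isCompact_Icc.exists_isMaxOn (nonempty_Icc.mpr ht) he.norm
  have hw : ∀ τ ∈ Icc 0 s, |θ ⬝ᵥ e τ| ≤ (∑ i, |θ i|) * ‖e s‖ := fun τ hτ =>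
    abs_dotProduct_le_of_norm_le θ (hmax ⟨hτ.1, hτ.2.trans hs.2⟩)
  have hbound : ‖e s‖ ≤ D + ρ * ‖e s‖ := calc
    ‖e s‖ = ‖(fun i => e s i - causalConv (fun σ => g σ i) (fun τ => θ ⬝ᵥ e τ) s)
        + fun i => causalConv (fun σ => g σ i) (fun τ => θ ⬝ᵥ e τ) s‖ := by
      congr 1
      ext i
      exact (sub_add_cancel _ _).symm
    _ ≤ D + ρ * ‖e s‖ := (norm_add_le _ _).trans (add_le_add (hD s hs)
      (norm_causalConv_le_of_l1Gain hg (hgain.trans ENNReal.one_lt_top) hs.1 (norm_nonneg _) hw))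
  have hmax_t : ‖e t‖ ≤ ‖e s‖ := hmax (right_mem_Icc.mpr ht)
  rw [inv_mul_eq_div, le_div_iff₀ hρ_lt]
  nlinarith

end SmallGain

section Lyapunov

variable {n : ℕ} {A P Q : Matrix (Fin n) (Fin n) ℝ}

theorem mulVec_dotProduct_add_dotProduct_mulVec (A D : Matrix (Fin n) (Fin n) ℝ)
    (z w : Fin n → ℝ) :
    (A *ᵥ z) ⬝ᵥ (D *ᵥ w) + z ⬝ᵥ (D *ᵥ (A *ᵥ w)) = z ⬝ᵥ ((Aᵀ * D + D * A) *ᵥ w) := by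
  rw [Matrix.add_mulVec, dotProduct_add, ← Matrix.mulVec_mulVec, ← Matrix.mulVec_mulVec,
    Matrix.dotProduct_mulVec z Aᵀ, Matrix.vecMul_transpose]

theorem hasDerivWithinAt_dotProduct_mulVec (D : Matrix (Fin n) (Fin n) ℝ)
    {f g : ℝ → Fin n → ℝ} {f' g' : Fin n → ℝ} {s : Set ℝ} {t : ℝ}
    (hf : HasDerivWithinAt f f' s t) (hg : HasDerivWithinAt g g' s t) :
    HasDerivWithinAt (fun τ => f τ ⬝ᵥ (D *ᵥ g τ)) (f' ⬝ᵥ (D *ᵥ g t) + f t ⬝ᵥ (D *ᵥ g')) s t :=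
  hasDerivWithinAt_dotProduct hf
    (hasDerivWithinAt_pi.mpr fun i => hasDerivWithinAt_const_dotProduct (D i) hg)

theorem hasDerivAt_dotProduct_mulVec_stateImpulse (A D : Matrix (Fin n) (Fin n) ℝ)
    (z w : Fin n → ℝ) (t : ℝ) :
    HasDerivAt (fun τ => stateImpulse A z τ ⬝ᵥ (D *ᵥ stateImpulse A w τ))
      (stateImpulse A z t ⬝ᵥ ((Aᵀ * D + D * A) *ᵥ stateImpulse A w t)) t := by
  rw [← mulVec_dotProduct_add_dotProduct_mulVec, ← hasDerivWithinAt_univ]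
  exact hasDerivWithinAt_dotProduct_mulVec D (hasDerivAt_stateImpulse A z t).hasDerivWithinAt
    (hasDerivAt_stateImpulse A w t).hasDerivWithinAt

theorem IsHurwitz.tendsto_dotProduct_mulVec_stateImpulse (hA : IsHurwitz A)
    (D : Matrix (Fin n) (Fin n) ℝ) (z w : Fin n → ℝ) :
    Tendsto (fun τ => stateImpulse A z τ ⬝ᵥ (D *ᵥ stateImpulse A w τ)) atTop (𝓝 0) := by
  have hcont : Continuous fun p : (Fin n → ℝ) × (Fin n → ℝ) => p.1 ⬝ᵥ (D *ᵥ p.2) :=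
    continuous_fst.dotProduct (continuous_const.matrix_mulVec continuous_snd)
  simpa only [Function.comp_def, Matrix.mulVec_zero, dotProduct_zero] using
    (hcont.tendsto (0, 0)).comp
      ((hA.tendsto_stateImpulse z).prodMk_nhds (hA.tendsto_stateImpulse w))

theorem IsHurwitz.eq_zero_of_lyapunov {D : Matrix (Fin n) (Fin n) ℝ} (hA : IsHurwitz A)
    (hD : Aᵀ * D + D * A = 0) : D = 0 := by
  have hform : ∀ z w : Fin n → ℝ, z ⬝ᵥ (D *ᵥ w) = 0 := fun z w => by
    have hderiv := hasDerivAt_dotProduct_mulVec_stateImpulse A D z w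
    simp only [hD, Matrix.zero_mulVec, dotProduct_zero] at hderiv
    have hconst := is_const_of_deriv_eq_zero (fun t => (hderiv t).differentiableAt)
      fun t => (hderiv t).deriv
    have hzero := tendsto_nhds_unique tendsto_const_nhds
      ((hA.tendsto_dotProduct_mulVec_stateImpulse D z w).congr fun t => hconst t 0)
    simpa only [stateImpulse_zero] using hzero
  ext i j
  simpa using hform (Pi.single i 1) (Pi.single j 1)

theorem IsHurwitz.transpose_eq_of_lyapunov (hA : IsHurwitz A) (hQ : Qᵀ = Q)
    (hP : Aᵀ * P + P * A = -Q) : Pᵀ = P := by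
  have hPt : Aᵀ * Pᵀ + Pᵀ * A = -Q := by
    rw [← hQ, ← Matrix.transpose_neg, ← hP, Matrix.transpose_add, Matrix.transpose_mul,
      Matrix.transpose_mul, Matrix.transpose_transpose, add_comm]
  refine sub_eq_zero.mp (hA.eq_zero_of_lyapunov ?_)
  rw [mul_sub, sub_mul, sub_add_sub_comm, hPt, hP, sub_self]

theorem IsHurwitz.posDef_of_lyapunov (hA : IsHurwitz A) (hQ : Q.PosDef)
    (hP : Aᵀ * P + P * A = -Q) : P.PosDef := by
  refine Matrix.PosDef.of_dotProduct_mulVec_pos ?_ fun z hz => ?_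
  · exact (Matrix.conjTranspose_eq_transpose_of_trivial P).trans (hA.transpose_eq_of_lyapunov
      ((Matrix.conjTranspose_eq_transpose_of_trivial Q).symm.trans hQ.isHermitian) hP)
  have hne : ∀ t, stateImpulse A z t ≠ 0 := fun t ht =>
    hz (Matrix.mulVec_injective_of_isUnit (Matrix.isUnit_exp (t • A))
      (ht.trans (Matrix.mulVec_zero _).symm))
  have hanti : StrictAnti fun τ => stateImpulse A z τ ⬝ᵥ (P *ᵥ stateImpulse A z τ) := by
    refine strictAnti_of_hasDerivAt_neg (hasDerivAt_dotProduct_mulVec_stateImpulse A P z z)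
      fun t => ?_
    rw [hP, Matrix.neg_mulVec, dotProduct_neg, neg_lt_zero]
    simpa only [star_trivial] using hQ.dotProduct_mulVec_pos (hne t)
  have hlim := hA.tendsto_dotProduct_mulVec_stateImpulse P z z
  have hpos := (hanti.antitone.le_of_tendsto hlim 1).trans_lt (hanti one_pos)
  simpa only [stateImpulse_zero, star_trivial] using hpos

theorem exists_mul_norm_sq_le_dotProduct_mulVec (hP : P.PosDef) :
    ∃ μ > 0, ∀ z : Fin n → ℝ, μ * ‖z‖ ^ 2 ≤ z ⬝ᵥ (P *ᵥ z) := by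
  have hcont : Continuous fun z : Fin n → ℝ => z ⬝ᵥ (P *ᵥ z) :=
    continuous_id.dotProduct (continuous_const.matrix_mulVec continuous_id)
  obtain ⟨μ, hμ, hsphere⟩ := (isCompact_sphere (0 : Fin n → ℝ) 1).exists_forall_le'
    hcont.continuousOn fun z hz => by
      simpa only [star_trivial] using
        hP.dotProduct_mulVec_pos (ne_zero_of_mem_unit_sphere ⟨z, hz⟩)
  refine ⟨μ, hμ, fun z => ?_⟩
  rcases eq_or_ne z 0 with rfl | hz
  · simp
  have hnorm : 0 < ‖z‖ := norm_pos_iff.mpr hz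
  have hunit := hsphere (‖z‖⁻¹ • z) (by
    rw [mem_sphere_zero_iff_norm, norm_smul, norm_inv, norm_norm, inv_mul_cancel₀ hnorm.ne'])
  rw [Matrix.mulVec_smul, dotProduct_smul, smul_dotProduct, smul_eq_mul, smul_eq_mul] at hunit
  calc μ * ‖z‖ ^ 2 ≤ (‖z‖⁻¹ * (‖z‖⁻¹ * z ⬝ᵥ (P *ᵥ z))) * ‖z‖ ^ 2 := by gcongr
    _ = z ⬝ᵥ (P *ᵥ z) := by field_simp

theorem hasDerivWithinAt_lyapunov (hP : Aᵀ * P + P * A = -Q) (hPsymm : Pᵀ = P) {b : Fin n → ℝ}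
    {z : ℝ → Fin n → ℝ} {η : ℝ} {s : Set ℝ} {t : ℝ}
    (hz : HasDerivWithinAt z (A *ᵥ z t - η • b) s t) :
    HasDerivWithinAt (fun τ => z τ ⬝ᵥ (P *ᵥ z τ))
      (-(z t ⬝ᵥ (Q *ᵥ z t)) - 2 * (η * (z t ⬝ᵥ (P *ᵥ b)))) s t := by
  refine (hasDerivWithinAt_dotProduct_mulVec P hz hz).congr_deriv ?_
  have hsymm : b ⬝ᵥ (P *ᵥ z t) = z t ⬝ᵥ (P *ᵥ b) := by
    rw [dotProduct_comm, ← Matrix.vecMul_transpose, hPsymm, ← Matrix.dotProduct_mulVec]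
  have hQ : (A *ᵥ z t) ⬝ᵥ (P *ᵥ z t) + z t ⬝ᵥ (P *ᵥ (A *ᵥ z t)) = -(z t ⬝ᵥ (Q *ᵥ z t)) := by
    rw [mulVec_dotProduct_add_dotProduct_mulVec, hP, Matrix.neg_mulVec, dotProduct_neg]
  rw [sub_dotProduct, smul_dotProduct, Matrix.mulVec_sub, Matrix.mulVec_smul, dotProduct_sub,
    dotProduct_smul, hsymm, smul_eq_mul, ← hQ]
  ring

end Lyapunov

section Projection

theorem smul_add_smul_mem_posTangentConeAt {E : Type*} [NormedAddCommGroup E]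
    [NormedSpace ℝ E] {Ω : Set E}
    (hΩ : Convex ℝ Ω) {ϑ d₁ d₂ : E} (hϑ : ϑ ∈ Ω) (hd₁ : ϑ + d₁ ∈ Ω) (hd₂ : ϑ + d₂ ∈ Ω)
    {c₁ c₂ : ℝ} (hc₁ : 0 ≤ c₁) (hc₂ : 0 ≤ c₂) :
    c₁ • d₁ + c₂ • d₂ ∈ posTangentConeAt Ω ϑ := by
  have hsmall : ∀ c : ℝ, ∀ᶠ t in 𝓝[>] (0 : ℝ), 2 * t * c ≤ 1 := fun c => by
    have hlim : Tendsto (fun t : ℝ => 2 * t * c) (𝓝 0) (𝓝 (2 * 0 * c)) :=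
      (tendsto_id.const_mul 2).mul_const c
    exact nhdsWithin_le_nhds (hlim.eventually_le_const (by norm_num))
  refine mem_posTangentConeAt_of_frequently_mem (Eventually.frequently ?_)
  filter_upwards [hsmall c₁, hsmall c₂, self_mem_nhdsWithin] with t h₁ h₂ (ht : 0 < t)
  convert hΩ.midpoint_mem (hΩ.add_smul_mem hϑ hd₁ ⟨by positivity, h₁⟩)
    (hΩ.add_smul_mem hϑ hd₂ ⟨by positivity, h₂⟩) using 1
  rw [midpoint_eq_smul_add, invOf_eq_inv]
  module

variable {n : ℕ} {Ω : Set (Fin n → ℝ)} {ϑ y v z : Fin n → ℝ}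

theorem IsProj.mem (hΩ : IsClosed Ω) (h : IsProj Ω ϑ y v) : ϑ ∈ Ω :=
  hΩ.closure_eq ▸ mem_closure_of_nonempty_tangentConeAt ⟨v, h.1⟩

theorem IsProj.le_of_convex (hΩ : Convex ℝ Ω) (h : IsProj Ω ϑ y v) (hϑ : ϑ ∈ Ω) (hz : z ∈ Ω)
    {s : ℝ} (hs : 0 ≤ s) :
    (y - v) ⬝ᵥ (y - v) ≤ (y - (v + s • (z - ϑ))) ⬝ᵥ (y - (v + s • (z - ϑ))) := by
  obtain ⟨ι, l, hl, c, d, -, hd, hcd⟩ := exists_fun_of_mem_tangentConeAt h.1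
  have hdist : Continuous fun w => (y - (w + s • (z - ϑ))) ⬝ᵥ (y - (w + s • (z - ϑ))) := by
    fun_prop
  refine ge_of_tendsto ((hdist.tendsto v).comp hcd) ?_
  filter_upwards [hd] with i hi
  exact h.2 _ (smul_add_smul_mem_posTangentConeAt hΩ hϑ hi (by rwa [add_sub_cancel])
    (c i).coe_nonneg hs)

theorem IsProj.dotProduct_nonpos (hΩ : Convex ℝ Ω) (h : IsProj Ω ϑ y v) (hϑ : ϑ ∈ Ω)
    (hz : z ∈ Ω) : (z - ϑ) ⬝ᵥ (y - v) ≤ 0 := by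
  have hexpand : ∀ (s : ℝ) (a w : Fin n → ℝ),
      (a - s • w) ⬝ᵥ (a - s • w) = a ⬝ᵥ a - s * (2 * (w ⬝ᵥ a) - s * (w ⬝ᵥ w)) := fun s a w => by
    simp only [sub_dotProduct, dotProduct_sub, smul_dotProduct, dotProduct_smul, smul_eq_mul,
      dotProduct_comm a w]
    ring
  have hquad : ∀ s > 0, 2 * ((z - ϑ) ⬝ᵥ (y - v)) ≤ s * ((z - ϑ) ⬝ᵥ (z - ϑ)) := fun s hs => by
    have hmin := h.le_of_convex hΩ hϑ hz hs.le
    rw [← sub_sub, hexpand, le_sub_self_iff] at hmin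
    exact sub_nonpos.mp (nonpos_of_mul_nonpos_right hmin hs)
  have hlim : Tendsto (fun s => s * ((z - ϑ) ⬝ᵥ (z - ϑ))) (𝓝[>] 0) (𝓝 0) := by
    simpa only [zero_mul] using
      ((continuous_mul_const ((z - ϑ) ⬝ᵥ (z - ϑ))).tendsto 0).mono_left nhdsWithin_le_nhds
  linarith [ge_of_tendsto hlim (eventually_nhdsWithin_of_forall hquad)]

end Projection

section AbsoluteContinuity

theorem absolutelyContinuousOnInterval_apply {ι : Type*} [Fintype ι] {f : ℝ → ι → ℝ} {a b : ℝ}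
    (hf : AbsolutelyContinuousOnInterval f a b) (i : ι) :
    AbsolutelyContinuousOnInterval (fun t => f t i) a b :=
  squeeze_zero (fun _ => Finset.sum_nonneg fun _ _ => dist_nonneg)
    (fun _ => Finset.sum_le_sum fun _ _ => dist_le_pi_dist _ _ i) hf

theorem absolutelyContinuousOnInterval_sum {ι : Type*} (s : Finset ι) {f : ι → ℝ → ℝ} {a b : ℝ}
    (hf : ∀ i ∈ s, AbsolutelyContinuousOnInterval (f i) a b) :
    AbsolutelyContinuousOnInterval (fun t => ∑ i ∈ s, f i t) a b := by
  classical
  induction s using Finset.induction_on with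
  | empty => exact (LipschitzWith.const (0 : ℝ)).lipschitzOnWith.absolutelyContinuousOnInterval
  | insert i s hi ih =>
    simp only [Finset.sum_insert hi]
    exact (hf i (Finset.mem_insert_self i s)).fun_add
      (ih fun j hj => hf j (Finset.mem_insert_of_mem hj))

theorem absolutelyContinuousOnInterval_dotProduct {ι : Type*} [Fintype ι] {f g : ℝ → ι → ℝ}
    {a b : ℝ} (hf : AbsolutelyContinuousOnInterval f a b)
    (hg : AbsolutelyContinuousOnInterval g a b) :
    AbsolutelyContinuousOnInterval (fun t => f t ⬝ᵥ g t) a b :=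
  absolutelyContinuousOnInterval_sum _ fun i _ =>
    (absolutelyContinuousOnInterval_apply hf i).fun_mul (absolutelyContinuousOnInterval_apply hg i)

theorem absolutelyContinuousOnInterval_of_hasDerivWithinAt {E : Type*} [NormedAddCommGroup E]
    [NormedSpace ℝ E] {f f' : ℝ → E} {a b : ℝ} (hf' : ContinuousOn f' (uIcc a b))
    (hf : ∀ t ∈ uIcc a b, HasDerivWithinAt f (f' t) (uIcc a b) t) :
    AbsolutelyContinuousOnInterval f a b := by
  obtain ⟨M, hM⟩ := isCompact_uIcc.exists_bound_of_continuousOn hf'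
  have hlip := (convex_uIcc a b).lipschitzOnWith_of_nnnorm_hasDerivWithin_le
    (C := M.toNNReal) hf fun t ht => NNReal.le_toNNReal_of_coe_le (hM t ht)
  exact hlip.absolutelyContinuousOnInterval

theorem continuousOn_Ici_of_absolutelyContinuousOnInterval {E : Type*}
    [SeminormedAddCommGroup E] {f : ℝ → E} {a : ℝ}
    (hf : ∀ T, a < T → AbsolutelyContinuousOnInterval f a T) :
    ContinuousOn f (Ici a) := by
  intro t (ht : a ≤ t)
  have ht' : t < t + 1 := lt_add_one t
  have hcont := (hf (t + 1) (ht.trans_lt ht')).continuousOn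
  rw [uIcc_of_le (ht.trans ht'.le)] at hcont
  refine (hcont t ⟨ht, ht'.le⟩).mono_of_mem_nhdsWithin ?_
  rw [← Ici_inter_Iic]
  exact inter_mem self_mem_nhdsWithin (nhdsWithin_le_nhds (Iic_mem_nhds ht'))

theorem le_of_ae_hasDerivAt_nonpos {f : ℝ → ℝ} {a b : ℝ} (hab : a ≤ b)
    (hf : AbsolutelyContinuousOnInterval f a b)
    (hf' : ∀ᵐ t ∂volume.restrict (Ioc a b), ∃ f' ≤ 0, HasDerivAt f f' t) : f b ≤ f a := by
  rw [← sub_nonpos, ← hf.integral_deriv_eq_sub, intervalIntegral.integral_of_le hab]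
  refine integral_nonpos_of_ae ?_
  filter_upwards [hf'] with t ⟨f', hnonpos, hderiv⟩
  exact hderiv.deriv.trans_le hnonpos

end AbsoluteContinuity

theorem ne_zero_of_transferAt_ne_zero {n : ℕ} {A : Matrix (Fin n) (Fin n) ℝ} {b c : Fin n → ℝ}
    {s : ℝ} (h : transferAt A b c s ≠ 0) : b ≠ 0 := by
  rintro rfl
  exact h (by rw [transferAt, Matrix.mulVec_zero, dotProduct_zero])

namespace Data

variable {n : ℕ} {S : Data n}

theorem mulVec_Am (S : Data n) (x : Fin n → ℝ) : S.Am *ᵥ x = S.A *ᵥ x - (S.K ⬝ᵥ x) • S.b := by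
  rw [Data.Am, Matrix.sub_mulVec, Matrix.vecMulVec_mulVec, op_smul_eq_smul]

theorem continuous_gBar (S : Data n) (i : Fin n) : Continuous fun t => S.gBar t i :=
  have hH := continuous_stateImpulse_apply S.Am S.b i
  (continuous_causalConv hH S.C.continuous_impulse).sub hH

theorem sum_abs_le_thetaMax (hΩ : IsCompact S.Ω) {ϑ : Fin n → ℝ} (hϑ : ϑ ∈ S.Ω) :
    ∑ i, |ϑ i| ≤ S.thetaMax :=
  le_csSup (hΩ.image (by fun_prop)).bddAbove
    (mem_image_of_mem (fun ϑ : Fin n → ℝ => ∑ i, |ϑ i|) hϑ)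

theorem GainRequirement.l1Gain_mul_sum_abs_lt_one (hgain : S.GainRequirement)
    (hΩ : IsCompact S.Ω) {ϑ : Fin n → ℝ} (hϑ : ϑ ∈ S.Ω) :
    l1Gain S.gBar * ENNReal.ofReal (∑ i, |ϑ i|) < 1 :=
  (mul_le_mul_right (ENNReal.ofReal_le_ofReal (sum_abs_le_thetaMax hΩ hϑ)) _).trans_lt hgain

theorem causalConv_gBar (S : Data n) {w : ℝ → ℝ} {t : ℝ} (ht : 0 ≤ t)
    (hw : ContinuousOn w (Icc 0 t)) (i : Fin n) :
    causalConv (fun s => S.gBar s i) w t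
      = causalConv (fun s => stateImpulse S.Am S.b s i) (S.C.response w) t
        - causalConv (fun s => stateImpulse S.Am S.b s i) w t := by
  have hH := continuous_stateImpulse_apply S.Am S.b i
  have hC := S.C.continuous_impulse
  rw [StrictlyProperSystem.response_eq_causalConv, causalConv_assoc hH hC ht hw]
  exact causalConv_sub_left (continuous_causalConv hH hC) hH (hw.intervalIntegrable_of_Icc ht)

theorem apply_sub_causalConv_gBar_eq {θ : Fin n → ℝ} {e : ℝ → Fin n → ℝ} {d : ℝ → ℝ}
    (he₀ : e 0 = 0) (hd : ContinuousOn d (Ici 0))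
    (he : ∀ τ, 0 ≤ τ → HasDerivWithinAt e (S.Am *ᵥ e τ
      + (S.C.response (fun s => θ ⬝ᵥ e s) τ - θ ⬝ᵥ e τ + d τ) • S.b) (Ici 0) τ)
    {t : ℝ} (ht : 0 ≤ t) (i : Fin n) :
    e t i - causalConv (fun s => S.gBar s i) (fun τ => θ ⬝ᵥ e τ) t
      = causalConv (fun s => stateImpulse S.Am S.b s i) d t := by
  have hH := continuous_stateImpulse_apply S.Am S.b i
  have hwc : ContinuousOn (fun τ => θ ⬝ᵥ e τ) (Ici 0) :=
    continuousOn_dotProduct continuousOn_const fun τ hτ => (he τ hτ).continuousWithinAt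
  have hint : ∀ {f : ℝ → ℝ}, ContinuousOn f (Ici 0) → IntervalIntegrable f volume 0 t :=
    fun hf => (hf.mono Icc_subset_Ici_self).intervalIntegrable_of_Icc ht
  have hCw : IntervalIntegrable (S.C.response fun τ => θ ⬝ᵥ e τ) volume 0 t :=
    hint (continuousOn_causalConv S.C.continuous_impulse hwc)
  have hCww := hCw.sub (hint hwc)
  rw [apply_eq_causalConv_of_hasDerivWithinAt he₀ he ht (hCww.add (hint hd)) i,
    causalConv_gBar S ht (hwc.mono Icc_subset_Ici_self), causalConv_add hH hCww (hint hd),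
    causalConv_sub hH hCw (hint hwc), add_sub_cancel_left]

theorem exists_norm_le_of_hasDerivWithinAt (hAm : IsHurwitz S.Am) {θ : Fin n → ℝ}
    (hgain : l1Gain S.gBar * ENNReal.ofReal (∑ i, |θ i|) < 1) :
    ∃ κ ≥ 0, ∀ (e : ℝ → Fin n → ℝ) (d : ℝ → ℝ) (D t : ℝ), e 0 = 0 → ContinuousOn d (Ici 0) →
      (∀ τ, 0 ≤ τ → HasDerivWithinAt e (S.Am *ᵥ e τ
        + (S.C.response (fun s => θ ⬝ᵥ e s) τ - θ ⬝ᵥ e τ + d τ) • S.b) (Ici 0) τ) →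
      0 ≤ t → (∀ τ ∈ Icc 0 t, |d τ| ≤ D) → ‖e t‖ ≤ κ * D := by
  obtain ⟨κ, hκ, hsmall⟩ := exists_norm_le_of_small_gain S.continuous_gBar hgain
  obtain ⟨κ', hκ', hconv⟩ := hAm.exists_norm_causalConv_le S.b
  refine ⟨κ * κ', mul_nonneg hκ hκ', fun e d D t he₀ hd he ht hD => ?_⟩
  rw [mul_assoc]
  refine hsmall e (κ' * D) t ht
    (fun τ hτ => (he τ hτ.1).continuousWithinAt.mono Icc_subset_Ici_self) fun s hs => ?_
  simp only [apply_sub_causalConv_gBar_eq he₀ hd he hs.1]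
  exact hconv d D s hs.1 fun τ hτ => hD τ ⟨hτ.1, hτ.2.trans hs.2⟩

/-- The Lyapunov function of the adaptive loop with gain `Γc`, as a function of the prediction
error `z = xhat - x` and of the estimation error `ϑ = θhat - θ`. It is `Γc` times the usual
`zᵀ P z + Γc⁻¹ ϑᵀ ϑ`, so that its initial value does not depend on `Γc`. -/
noncomputable def lyapunov (S : Data n) (Γc : ℝ) (z ϑ : Fin n → ℝ) : ℝ :=
  Γc * (z ⬝ᵥ (S.P *ᵥ z)) + ϑ ⬝ᵥ ϑ

theorem IsPlantSolution.continuousOn {x : ℝ → Fin n → ℝ} {u : ℝ → ℝ}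
    (h : S.IsPlantSolution x u) : ContinuousOn x (Ici 0) :=
  fun t ht => (h.2 t ht).continuousWithinAt

namespace IsAdaptiveLoop

variable {Γc : ℝ} {x xhat θhat : ℝ → Fin n → ℝ} {u : ℝ → ℝ} {Q : Matrix (Fin n) (Fin n) ℝ}

theorem continuousOn_mismatch (h : S.IsAdaptiveLoop Γc x xhat θhat u) :
    ContinuousOn (fun τ => (θhat τ - S.θ) ⬝ᵥ x τ) (Ici 0) :=
  continuousOn_dotProduct ((continuousOn_Ici_of_absolutelyContinuousOnInterval h.estimate_ac).sub
    continuousOn_const) h.plant.continuousOn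

theorem predictionError_zero (h : S.IsAdaptiveLoop Γc x xhat θhat u) : xhat 0 - x 0 = 0 := by
  rw [h.predictor_init, h.plant.1, sub_self]

theorem hasDerivWithinAt_predictionError (h : S.IsAdaptiveLoop Γc x xhat θhat u) {t : ℝ}
    (ht : 0 ≤ t) : HasDerivWithinAt (fun τ => xhat τ - x τ)
      (S.Am *ᵥ (xhat t - x t) - ((θhat t - S.θ) ⬝ᵥ x t) • S.b) (Ici 0) t := by
  refine ((h.predictor t ht).sub (h.plant.2 t ht)).congr_deriv ?_
  rw [h.control t ht, Matrix.mulVec_sub, S.mulVec_Am (x t), sub_dotProduct]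
  module

theorem absolutelyContinuousOnInterval_lyapunov (h : S.IsAdaptiveLoop Γc x xhat θhat u)
    (hP : S.Amᵀ * S.P + S.P * S.Am = -Q) (hPsymm : S.Pᵀ = S.P) {t : ℝ} (ht : 0 < t) :
    AbsolutelyContinuousOnInterval
      (fun τ => S.lyapunov Γc (xhat τ - x τ) (θhat τ - S.θ)) 0 t := by
  have hsub : uIcc 0 t ⊆ Ici 0 := uIcc_of_le ht.le ▸ Icc_subset_Ici_self
  have hz : ContinuousOn (fun τ => xhat τ - x τ) (Ici 0) := fun τ hτ =>
    (h.hasDerivWithinAt_predictionError hτ).continuousWithinAt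
  have hQz : ContinuousOn (fun τ => Q *ᵥ (xhat τ - x τ)) (Ici 0) :=
    (Continuous.matrix_mulVec continuous_const continuous_id).comp_continuousOn hz
  have hcont : ContinuousOn (fun τ => -((xhat τ - x τ) ⬝ᵥ (Q *ᵥ (xhat τ - x τ)))
      - 2 * ((θhat τ - S.θ) ⬝ᵥ x τ * ((xhat τ - x τ) ⬝ᵥ (S.P *ᵥ S.b)))) (uIcc 0 t) :=
    ((continuousOn_dotProduct hz hQz).neg.sub (continuousOn_const.mul (h.continuousOn_mismatch.mul
      (continuousOn_dotProduct hz continuousOn_const)))).mono hsub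
  have hθ : AbsolutelyContinuousOnInterval (fun τ => θhat τ - S.θ) 0 t :=
    (h.estimate_ac t ht).fun_sub
      (LipschitzWith.const S.θ).lipschitzOnWith.absolutelyContinuousOnInterval
  exact ((absolutelyContinuousOnInterval_of_hasDerivWithinAt hcont fun τ hτ =>
    (hasDerivWithinAt_lyapunov hP hPsymm (h.hasDerivWithinAt_predictionError (hsub hτ))).mono
      hsub).const_mul Γc).fun_add (absolutelyContinuousOnInterval_dotProduct hθ hθ)

theorem ae_hasDerivAt_lyapunov_nonpos (h : S.IsAdaptiveLoop Γc x xhat θhat u) (hΓc : 0 ≤ Γc)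
    (hΩ_closed : IsClosed S.Ω) (hΩ_convex : Convex ℝ S.Ω) (hθ : S.θ ∈ S.Ω) (hQ : Q.PosSemidef)
    (hP : S.Amᵀ * S.P + S.P * S.Am = -Q) (hPsymm : S.Pᵀ = S.P) :
    ∀ᵐ t ∂volume.restrict (Ioi (0 : ℝ)), ∃ V' ≤ 0,
      HasDerivAt (fun τ => S.lyapunov Γc (xhat τ - x τ) (θhat τ - S.θ)) V' t := by
  filter_upwards [ae_restrict_of_ae_restrict_of_subset Ioi_subset_Ici_self h.adaptation,
    ae_restrict_mem measurableSet_Ioi] with t ⟨v, hproj, hθhat⟩ (ht : 0 < t)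
  have hz := (hasDerivWithinAt_lyapunov hP hPsymm
    (h.hasDerivWithinAt_predictionError ht.le)).hasDerivAt (Ici_mem_nhds ht)
  have hϑ := (hθhat.sub_const S.θ).hasDerivWithinAt (s := univ)
  have hϑ' := hasDerivWithinAt_univ.mp (hasDerivWithinAt_dotProduct hϑ hϑ)
  refine ⟨_, ?_, (hz.const_mul Γc).add hϑ'⟩
  set z := xhat t - x t
  have hvar : (z ⬝ᵥ (S.P *ᵥ S.b)) * (-((θhat t - S.θ) ⬝ᵥ x t)) + (θhat t - S.θ) ⬝ᵥ v ≤ 0 := by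
    have hvi := hproj.dotProduct_nonpos hΩ_convex (hproj.mem hΩ_closed) hθ
    rw [← neg_sub (θhat t) S.θ, neg_dotProduct, dotProduct_sub, dotProduct_smul, smul_eq_mul]
      at hvi
    linarith
  have hQz : 0 ≤ z ⬝ᵥ (Q *ᵥ z) := by
    simpa only [star_trivial] using hQ.dotProduct_mulVec_nonneg z
  calc Γc * (-(z ⬝ᵥ (Q *ᵥ z)) - 2 * ((θhat t - S.θ) ⬝ᵥ x t * (z ⬝ᵥ (S.P *ᵥ S.b))))
        + ((Γc • v) ⬝ᵥ (θhat t - S.θ) + (θhat t - S.θ) ⬝ᵥ (Γc • v))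
      = Γc * (-(z ⬝ᵥ (Q *ᵥ z)) + 2 * ((z ⬝ᵥ (S.P *ᵥ S.b)) * (-((θhat t - S.θ) ⬝ᵥ x t))
          + (θhat t - S.θ) ⬝ᵥ v)) := by
        rw [dotProduct_comm (Γc • v), dotProduct_smul, smul_eq_mul]
        ring
    _ ≤ 0 := mul_nonpos_of_nonneg_of_nonpos hΓc (by linarith)

theorem lyapunov_le (h : S.IsAdaptiveLoop Γc x xhat θhat u) (hΓc : 0 ≤ Γc)
    (hΩ_closed : IsClosed S.Ω) (hΩ_convex : Convex ℝ S.Ω) (hθ : S.θ ∈ S.Ω) (hQ : Q.PosSemidef)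
    (hP : S.Amᵀ * S.P + S.P * S.Am = -Q) (hPsymm : S.Pᵀ = S.P) {t : ℝ} (ht : 0 ≤ t) :
    S.lyapunov Γc (xhat t - x t) (θhat t - S.θ) ≤ (S.θhat₀ - S.θ) ⬝ᵥ (S.θhat₀ - S.θ) := by
  have hinit : S.lyapunov Γc (xhat 0 - x 0) (θhat 0 - S.θ)
      = (S.θhat₀ - S.θ) ⬝ᵥ (S.θhat₀ - S.θ) := by
    rw [lyapunov, h.predictionError_zero, h.estimate_init, zero_dotProduct, mul_zero, zero_add]
  rcases ht.eq_or_lt with rfl | hpos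
  · exact hinit.le
  rw [← hinit]
  exact le_of_ae_hasDerivAt_nonpos ht (h.absolutelyContinuousOnInterval_lyapunov hP hPsymm hpos)
    (ae_restrict_of_ae_restrict_of_subset Ioc_subset_Ioi_self
      (h.ae_hasDerivAt_lyapunov_nonpos hΓc hΩ_closed hΩ_convex hθ hQ hP hPsymm))

end IsAdaptiveLoop

end Data

namespace Data

variable {n : ℕ} {S : Data n}

namespace IsAdaptiveLoop

variable {Γc : ℝ} {x xhat θhat xref : ℝ → Fin n → ℝ} {u uref : ℝ → ℝ}

theorem response_eq_add (h : S.IsAdaptiveLoop Γc x xhat θhat u)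
    (href : S.IsReferenceLoop xref uref) (hr : LocallyIntegrableOn S.r (Ici 0)) {t : ℝ}
    (ht : 0 ≤ t) :
    S.C.response (fun τ => θhat τ ⬝ᵥ x τ + S.kg * S.r τ) t
      = S.C.response (fun τ => S.kg * S.r τ + S.θ ⬝ᵥ xref τ) t
        + (S.C.response (fun τ => S.θ ⬝ᵥ (x τ - xref τ)) t
          + S.C.response (fun τ => (θhat τ - S.θ) ⬝ᵥ x τ) t) := by
  have hint : ∀ {f : ℝ → ℝ}, ContinuousOn f (Ici 0) → IntervalIntegrable f volume 0 t :=
    fun hf => (hf.mono Icc_subset_Ici_self).intervalIntegrable_of_Icc ht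
  have hrint : IntervalIntegrable (fun τ => S.kg * S.r τ) volume 0 t :=
    ((intervalIntegrable_iff_integrableOn_Icc_of_le ht).mpr
      (hr.integrableOn_compact_subset Icc_subset_Ici_self isCompact_Icc)).const_mul _
  have hxref : IntervalIntegrable (fun τ => S.θ ⬝ᵥ xref τ) volume 0 t :=
    hint (continuousOn_dotProduct continuousOn_const href.plant.continuousOn)
  have he : IntervalIntegrable (fun τ => S.θ ⬝ᵥ (x τ - xref τ)) volume 0 t :=
    hint (continuousOn_dotProduct continuousOn_const
      (h.plant.continuousOn.sub href.plant.continuousOn))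
  have hη := hint h.continuousOn_mismatch
  simp only [StrictlyProperSystem.response_eq_causalConv]
  rw [← causalConv_add S.C.continuous_impulse he hη,
    ← causalConv_add S.C.continuous_impulse (hrint.add hxref) (he.add hη)]
  refine causalConv_congr ht fun τ _ => ?_
  rw [dotProduct_sub, sub_dotProduct]
  ring

theorem control_sub_eq (h : S.IsAdaptiveLoop Γc x xhat θhat u)
    (href : S.IsReferenceLoop xref uref) (hr : LocallyIntegrableOn S.r (Ici 0)) {t : ℝ}
    (ht : 0 ≤ t) :
    u t - uref t = S.C.response (fun τ => S.θ ⬝ᵥ (x τ - xref τ)) t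
      + S.C.response (fun τ => (θhat τ - S.θ) ⬝ᵥ x τ) t - S.K ⬝ᵥ (x t - xref t) := by
  rw [h.control t ht, href.control t ht, h.response_eq_add href hr ht, dotProduct_sub S.K]
  ring

theorem hasDerivWithinAt_trackingError (h : S.IsAdaptiveLoop Γc x xhat θhat u)
    (href : S.IsReferenceLoop xref uref) (hr : LocallyIntegrableOn S.r (Ici 0)) {t : ℝ}
    (ht : 0 ≤ t) :
    HasDerivWithinAt (fun τ => x τ - xref τ) (S.Am *ᵥ (x t - xref t)
      + (S.C.response (fun τ => S.θ ⬝ᵥ (x τ - xref τ)) t - S.θ ⬝ᵥ (x t - xref t)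
        + S.C.response (fun τ => (θhat τ - S.θ) ⬝ᵥ x τ) t) • S.b) (Ici 0) t := by
  refine ((h.plant.2 t ht).sub (href.plant.2 t ht)).congr_deriv ?_
  rw [eq_add_of_sub_eq (h.control_sub_eq href hr ht), S.mulVec_Am (x t - xref t),
    Matrix.mulVec_sub, dotProduct_sub S.θ (x t)]
  module

end IsAdaptiveLoop

theorem exists_norm_predictionError_le {Q : Matrix (Fin n) (Fin n) ℝ} (hΩ_closed : IsClosed S.Ω)
    (hΩ_convex : Convex ℝ S.Ω) (hθ : S.θ ∈ S.Ω) (hAm : IsHurwitz S.Am) (hQ : Q.PosDef)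
    (hP : S.Amᵀ * S.P + S.P * S.Am = -Q) :
    ∃ κ, ∀ Γc x xhat θhat u, 0 < Γc → S.IsAdaptiveLoop Γc x xhat θhat u →
      ∀ t, 0 ≤ t → ‖xhat t - x t‖ ≤ κ * √(Γc⁻¹) := by
  have hPpos := hAm.posDef_of_lyapunov hQ hP
  have hPsymm : S.Pᵀ = S.P :=
    (conjTranspose_eq_transpose_of_trivial S.P).symm.trans hPpos.isHermitian
  obtain ⟨μ, hμ, hμP⟩ := exists_mul_norm_sq_le_dotProduct_mulVec hPpos
  set V₀ := (S.θhat₀ - S.θ) ⬝ᵥ (S.θhat₀ - S.θ)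
  refine ⟨√(V₀ / μ), fun Γc x xhat θhat u hΓc h t ht => ?_⟩
  have hbound : Γc * (μ * ‖xhat t - x t‖ ^ 2) ≤ V₀ := calc
    Γc * (μ * ‖xhat t - x t‖ ^ 2) ≤ Γc * ((xhat t - x t) ⬝ᵥ (S.P *ᵥ (xhat t - x t))) :=
      mul_le_mul_of_nonneg_left (hμP _) hΓc.le
    _ ≤ S.lyapunov Γc (xhat t - x t) (θhat t - S.θ) :=
      le_add_of_nonneg_right (Finset.sum_nonneg fun _ _ => mul_self_nonneg _)
    _ ≤ V₀ := h.lyapunov_le hΓc.le hΩ_closed hΩ_convex hθ hQ.posSemidef hP hPsymm ht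
  rw [← Real.sqrt_mul' _ (inv_nonneg.mpr hΓc.le)]
  refine Real.le_sqrt_of_sq_le ?_
  rw [← div_eq_mul_inv, div_div, le_div_iff₀ (mul_pos hμ hΓc)]
  linarith

theorem exists_abs_response_mismatch_le (hC : S.C.IsStable) (hb : S.b ≠ 0) :
    ∃ κ, ∀ Γc x xhat θhat u X, S.IsAdaptiveLoop Γc x xhat θhat u →
      (∀ t, 0 ≤ t → ‖xhat t - x t‖ ≤ X) →
      ∀ t, 0 ≤ t → |S.C.response (fun τ => (θhat τ - S.θ) ⬝ᵥ x τ) t| ≤ κ * X := by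
  obtain ⟨κ, -, hκ⟩ := hC.exists_abs_response_le_of_state S.Am hb
  refine ⟨κ, fun Γc x xhat θhat u X h hX t ht => ?_⟩
  exact hκ _ _ X t h.predictionError_zero (fun τ hτ => h.hasDerivWithinAt_predictionError hτ) ht
    ((h.continuousOn_mismatch.mono Icc_subset_Ici_self).intervalIntegrable_of_Icc ht)
    fun τ hτ => hX τ hτ.1

theorem exists_norm_trackingError_le (hAm : IsHurwitz S.Am)
    (hgain : l1Gain S.gBar * ENNReal.ofReal (∑ i, |S.θ i|) < 1)
    (hr : LocallyIntegrableOn S.r (Ici 0)) {xref : ℝ → Fin n → ℝ} {uref : ℝ → ℝ}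
    (href : S.IsReferenceLoop xref uref) :
    ∃ κ, ∀ Γc x xhat θhat u D, S.IsAdaptiveLoop Γc x xhat θhat u →
      (∀ t, 0 ≤ t → |S.C.response (fun τ => (θhat τ - S.θ) ⬝ᵥ x τ) t| ≤ D) →
      ∀ t, 0 ≤ t → ‖x t - xref t‖ ≤ κ * D := by
  obtain ⟨κ, -, hκ⟩ := exists_norm_le_of_hasDerivWithinAt hAm hgain
  refine ⟨κ, fun Γc x xhat θhat u D h hD t ht => ?_⟩
  exact hκ _ _ D t (by rw [h.plant.1, href.plant.1, sub_self])
    (continuousOn_causalConv S.C.continuous_impulse h.continuousOn_mismatch)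
    (fun τ hτ => h.hasDerivWithinAt_trackingError href hr hτ) ht fun τ hτ => hD τ hτ.1

theorem exists_abs_control_sub_le (hC : S.C.IsStable) (hr : LocallyIntegrableOn S.r (Ici 0))
    {xref : ℝ → Fin n → ℝ} {uref : ℝ → ℝ} (href : S.IsReferenceLoop xref uref) :
    ∃ κ, ∀ Γc x xhat θhat u D E, S.IsAdaptiveLoop Γc x xhat θhat u →
      (∀ t, 0 ≤ t → |S.C.response (fun τ => (θhat τ - S.θ) ⬝ᵥ x τ) t| ≤ D) →
      (∀ t, 0 ≤ t → ‖x t - xref t‖ ≤ E) → ∀ t, 0 ≤ t → |u t - uref t| ≤ κ * E + D := by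
  obtain ⟨κ, -, hκ⟩ := hC.exists_abs_response_le
  refine ⟨κ * ∑ i, |S.θ i| + ∑ i, |S.K i|, fun Γc x xhat θhat u D E h hD hE t ht => ?_⟩
  have hfeedback := abs_dotProduct_le_of_norm_le S.K (hE t ht)
  have hfiltered := hκ (fun τ => S.θ ⬝ᵥ (x τ - xref τ)) _ t ht fun τ hτ =>
    abs_dotProduct_le_of_norm_le S.θ (hE τ hτ.1)
  rw [h.control_sub_eq href hr ht]
  linarith [abs_sub (S.C.response (fun τ => S.θ ⬝ᵥ (x τ - xref τ)) t
      + S.C.response (fun τ => (θhat τ - S.θ) ⬝ᵥ x τ) t) (S.K ⬝ᵥ (x t - xref t)),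
    abs_add_le (S.C.response (fun τ => S.θ ⬝ᵥ (x τ - xref τ)) t)
      (S.C.response (fun τ => (θhat τ - S.θ) ⬝ᵥ x τ) t), hD t ht]

theorem exists_tracking_bound {Q : Matrix (Fin n) (Fin n) ℝ} (hΩ_compact : IsCompact S.Ω)
    (hΩ_convex : Convex ℝ S.Ω) (hθ : S.θ ∈ S.Ω) (hr : LocallyIntegrableOn S.r (Ici 0))
    (hAm : IsHurwitz S.Am) (hQ : Q.PosDef) (hP : S.Amᵀ * S.P + S.P * S.Am = -Q)
    (hC : S.C.IsStable) (hb : S.b ≠ 0) (hgain : S.GainRequirement) {xref : ℝ → Fin n → ℝ}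
    {uref : ℝ → ℝ} (href : S.IsReferenceLoop xref uref) :
    ∃ κx κu, ∀ Γc x xhat θhat u, 0 < Γc → S.IsAdaptiveLoop Γc x xhat θhat u → ∀ t, 0 ≤ t →
      ‖x t - xref t‖ ≤ κx * √(Γc⁻¹) ∧ |u t - uref t| ≤ κu * √(Γc⁻¹) := by
  obtain ⟨κz, hz⟩ := exists_norm_predictionError_le hΩ_compact.isClosed hΩ_convex hθ hAm hQ hP
  obtain ⟨κη, hη⟩ := exists_abs_response_mismatch_le hC hb
  obtain ⟨κe, he⟩ := exists_norm_trackingError_le hAm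
    (hgain.l1Gain_mul_sum_abs_lt_one hΩ_compact hθ) hr href
  obtain ⟨κu, hu⟩ := exists_abs_control_sub_le hC hr href
  refine ⟨κe * (κη * κz), κu * (κe * (κη * κz)) + κη * κz, fun Γc x xhat θhat u hΓc h => ?_⟩
  simp only [add_mul, mul_assoc]
  have hηΓ := hη Γc x xhat θhat u _ h (hz Γc x xhat θhat u hΓc h)
  have heΓ := he Γc x xhat θhat u _ h hηΓ
  exact fun t ht => ⟨heΓ t ht, hu Γc x xhat θhat u _ _ h hηΓ heΓ t ht⟩

end Data

theorem tendstoUniformlyOn_zero_of_norm_le {α E : Type*} [SeminormedAddCommGroup E]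
    {F : ℝ → α → E} {s : Set α} {κ : ℝ}
    (h : ∀ Γ, 0 < Γ → ∀ t ∈ s, ‖F Γ t‖ ≤ κ * √(Γ⁻¹)) :
    TendstoUniformlyOn F (fun _ => 0) atTop s := by
  have hlim : Tendsto (fun Γ : ℝ => κ * √(Γ⁻¹)) atTop (𝓝 0) := by
    simpa only [Real.sqrt_zero, mul_zero] using tendsto_inv_atTop_zero.sqrt.const_mul κ
  rw [Metric.tendstoUniformlyOn_iff]
  intro ε hε
  filter_upwards [hlim.eventually_lt_const hε, eventually_gt_atTop 0] with Γ hΓε hΓ t ht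
  rw [dist_zero_left]
  exact (h Γ hΓ t ht).trans_lt hΓε

end L1Adaptive

theorem corollary1_general {n : ℕ} (S : L1Adaptive.Data n) (Q : Matrix (Fin n) (Fin n) ℝ)
    (hΩ_compact : IsCompact S.Ω) (hΩ_convex : Convex ℝ S.Ω) (hθ : S.θ ∈ S.Ω)
    (hr : LocallyIntegrableOn S.r (Ici 0)) (hAm : L1Adaptive.IsHurwitz S.Am)
    (hQ : Q.PosDef) (hP : S.Amᵀ * S.P + S.P * S.Am = -Q) (hC_stable : S.C.IsStable)
    (hkg : L1Adaptive.transferAt S.Am S.b S.c 0 ≠ 0) (hgain : S.GainRequirement)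
    (xref : ℝ → Fin n → ℝ) (uref : ℝ → ℝ) (href : S.IsReferenceLoop xref uref)
    (x xhat θhat : ℝ → ℝ → Fin n → ℝ) (u : ℝ → ℝ → ℝ)
    (hloop : ∀ Γc, 0 < Γc → S.IsAdaptiveLoop Γc (x Γc) (xhat Γc) (θhat Γc) (u Γc)) :
    (∀ t, 0 ≤ t →
      Tendsto (fun Γc => x Γc t - xref t) atTop (𝓝 0) ∧
      Tendsto (fun Γc => S.c ⬝ᵥ x Γc t - S.c ⬝ᵥ xref t) atTop (𝓝 0) ∧
      Tendsto (fun Γc => u Γc t - uref t) atTop (𝓝 0)) ∧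
    TendstoUniformlyOn (fun Γc t => x Γc t - xref t) (fun _ => 0) atTop (Ici 0) ∧
    TendstoUniformlyOn (fun Γc t => S.c ⬝ᵥ x Γc t - S.c ⬝ᵥ xref t) (fun _ => 0) atTop (Ici 0) ∧
    TendstoUniformlyOn (fun Γc t => u Γc t - uref t) (fun _ => 0) atTop (Ici 0) := by
  obtain ⟨κx, κu, hκ⟩ := L1Adaptive.Data.exists_tracking_bound hΩ_compact hΩ_convex hθ hr hAm hQ hP
    hC_stable (L1Adaptive.ne_zero_of_transferAt_ne_zero hkg) hgain href
  have hbound := fun Γc hΓc => hκ Γc _ _ _ _ hΓc (hloop Γc hΓc)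
  have hx : TendstoUniformlyOn (fun Γc t => x Γc t - xref t) (fun _ => 0) atTop (Ici 0) :=
    L1Adaptive.tendstoUniformlyOn_zero_of_norm_le fun Γc hΓc t ht => (hbound Γc hΓc t ht).1
  have hu : TendstoUniformlyOn (fun Γc t => u Γc t - uref t) (fun _ => 0) atTop (Ici 0) :=
    L1Adaptive.tendstoUniformlyOn_zero_of_norm_le fun Γc hΓc t ht => (hbound Γc hΓc t ht).2
  have hy : TendstoUniformlyOn (fun Γc t => S.c ⬝ᵥ x Γc t - S.c ⬝ᵥ xref t) (fun _ => 0) atTop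
      (Ici 0) :=
    L1Adaptive.tendstoUniformlyOn_zero_of_norm_le (κ := (∑ i, |S.c i|) * κx) fun Γc hΓc t ht => by
      rw [← dotProduct_sub, Real.norm_eq_abs, mul_assoc]
      exact L1Adaptive.abs_dotProduct_le_of_norm_le S.c (hbound Γc hΓc t ht).1
  exact ⟨fun t ht => ⟨hx.tendsto_at ht, hy.tendsto_at ht, hu.tendsto_at ht⟩, hx, hy, hu⟩

theorem corollary1 {n : ℕ} (S : L1Adaptive.Data n) (Q : Matrix (Fin n) (Fin n) ℝ)
    -- the plant
    (hctrl : L1Adaptive.IsControllable S.A S.b)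
    (hΩ_compact : IsCompact S.Ω) (hΩ_convex : Convex ℝ S.Ω) (hθ : S.θ ∈ S.Ω)
    -- the reference signal is bounded and continuous
    (hr_cont : ContinuousOn S.r (Ici 0)) (hr_bdd : ∃ M : ℝ, ∀ t, 0 ≤ t → |S.r t| ≤ M)
    -- the controller
    (hAm : L1Adaptive.IsHurwitz S.Am)
    (hQ : Q.PosDef) (hP : S.Amᵀ * S.P + S.P * S.Am = -Q)
    (hC_stable : S.C.IsStable) (hC_dc : S.C.transfer 0 = 1)
    (hkg : L1Adaptive.transferAt S.Am S.b S.c 0 ≠ 0)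
    (hθhat₀ : S.θhat₀ ∈ S.Ω)
    (hgain : S.GainRequirement)
    -- the reference system
    (xref : ℝ → Fin n → ℝ) (uref : ℝ → ℝ) (href : S.IsReferenceLoop xref uref)
    -- the closed-loop signals for each adaptation gain
    (x xhat θhat : ℝ → ℝ → Fin n → ℝ) (u : ℝ → ℝ → ℝ)
    (hloop : ∀ Γc, 0 < Γc → S.IsAdaptiveLoop Γc (x Γc) (xhat Γc) (θhat Γc) (u Γc)) :
    (∀ t, 0 ≤ t →
      Tendsto (fun Γc => x Γc t - xref t) atTop (𝓝 0) ∧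
      Tendsto (fun Γc => S.c ⬝ᵥ x Γc t - S.c ⬝ᵥ xref t) atTop (𝓝 0) ∧
      Tendsto (fun Γc => u Γc t - uref t) atTop (𝓝 0)) ∧
    TendstoUniformlyOn (fun Γc t => x Γc t - xref t) (fun _ => 0) atTop (Ici 0) ∧
    TendstoUniformlyOn (fun Γc t => S.c ⬝ᵥ x Γc t - S.c ⬝ᵥ xref t) (fun _ => 0) atTop (Ici 0) ∧
    TendstoUniformlyOn (fun Γc t => u Γc t - uref t) (fun _ => 0) atTop (Ici 0) :=
  corollary1_general S Q hΩ_compact hΩ_convex hθ (hr_cont.locallyIntegrableOn measurableSet_Ici)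
    hAm hQ hP hC_stable hkg hgain xref uref href x xhat θhat u hloop
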